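/- Let $M$ be a compact connected Riemann surface, $E\to M$ a holomorphic vector bundle of finite rank with a smooth Hermitian metric $h$, and $dV$ a smooth (positive) volume form on $M$. Let $D\subset M$ be a domain (a nonempty connected open set) and $K=M\setminus D$. Let $\mathcal O L^2(E|_D)$ be the vector space of holomorphic sections $s$ of $E$ over $D$ with $$\|s\|^2=\int_D h(s,s)\,dV<\infty ,$$ and let $H^0(M,E)$ be the vector space of global holomorphic sections of $E$. Suppose that $K$ is locally polar, i.e. every point $p\in K$ has a connected open neighbourhood $U\subset M$ with a subharmonic function $\varphi:U\to[-\infty,\infty)$, $\varphi\not\equiv-\infty$, such that $K\cap U\subset\{y\in U:\varphi(y)=-\infty\}$. Then $\mathcal O L^2(E|_D)=H^0(M,E)$, in the sense that the restriction $s\mapsto s|_D$ is a linear isomorphism from $H^0(M,E)$ onto $\mathcal O L^2(E|_D)$. In particular, every holomorphic $L^2$ section of $E$ over $D$ extends to a global holomorphic section, and the extension is unique. -/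

import Mathlib

open Bundle Set Filter Topology MeasureTheory TopologicalSpace
open scoped Manifold ContDiff ENNReal

/-! ### Subharmonic functions and locally polar sets -/

/-- The mean over the circle of centre `c` and radius `r` of an extended-real function: the mean of
the positive part minus the mean of the negative part. (For an upper semicontinuous function
without the value `⊤` on the circle, the first term is finite, and the mean may be `⊥`.) -/
noncomputable def circleMean (u : ℂ → EReal) (c : ℂ) (r : ℝ) : EReal :=
  ((laverage (volume.restrict (Ioc 0 (2 * Real.pi)))
    fun θ => (u (circleMap c r θ)).toENNReal : ℝ≥0∞) : EReal) -
    ((laverage (volume.restrict (Ioc 0 (2 * Real.pi)))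
    fun θ => (-u (circleMap c r θ)).toENNReal : ℝ≥0∞) : EReal)

/-- `u : Ω → [-∞, ∞)` is subharmonic on the open set `Ω ⊆ ℂ`: it is upper semicontinuous and
satisfies the sub-mean value inequality for all closed disks contained in `Ω`.
The constant `-∞` is allowed. -/
def IsSubharmonicOnPlane (u : ℂ → EReal) (Ω : Set ℂ) : Prop :=
  UpperSemicontinuousOn u Ω ∧ (∀ z ∈ Ω, u z ≠ ⊤) ∧
    ∀ (c : ℂ) (r : ℝ), 0 < r → Metric.closedBall c r ⊆ Ω → u c ≤ circleMean u c r

section RiemannSurface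

variable {M : Type*} [TopologicalSpace M] [ChartedSpace ℂ M]

/-- `φ : U → [-∞, ∞)` is subharmonic on the open subset `U` of a Riemann surface: it is so in every
holomorphic chart. Values of `φ` outside `U` are irrelevant. -/
def IsSubharmonicOn (φ : M → EReal) (U : Set M) : Prop :=
  ∀ e ∈ IsManifold.maximalAtlas 𝓘(ℂ, ℂ) ω M,
    IsSubharmonicOnPlane (fun z => φ (e.symm z)) (e.target ∩ e.symm ⁻¹' U)

/-- A subset `K` of a Riemann surface is locally polar if every point of `K` has a connected (open)
neighbourhood `U` with a subharmonic function `φ ≢ -∞` on `U` that is `-∞` on `K ∩ U`. -/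
def IsLocallyPolar (K : Set M) : Prop :=
  ∀ p ∈ K, ∃ U : Set M, IsOpen U ∧ IsConnected U ∧ p ∈ U ∧
    ∃ φ : M → EReal, IsSubharmonicOn φ U ∧ (∃ y ∈ U, φ y ≠ ⊥) ∧ K ∩ U ⊆ {y ∈ U | φ y = ⊥}

/-! ### Smooth volume forms -/

/-- `μ` is the measure given by a smooth (positive) volume form `dV`: in each chart `z = x + iy`,
`dV = ρ dx ∧ dy` with a smooth function `ρ > 0`. -/
def IsSmoothVolume [MeasurableSpace M] (μ : Measure M) : Prop :=
  ∀ e ∈ atlas ℂ M, ∃ ρ : ℂ → ℝ, ContDiffOn ℝ ∞ ρ e.target ∧ (∀ z ∈ e.target, 0 < ρ z) ∧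
    ∀ A ⊆ e.source, MeasurableSet A → μ A = ∫⁻ z in e '' A, ENNReal.ofReal (ρ z)

end RiemannSurface

/-! ### Hermitian metrics and holomorphic `L²` sections -/

section Sections

set_option linter.unusedSectionVars false

variable {M : Type*} [TopologicalSpace M] [ChartedSpace ℂ M]
  (F : Type*) [NormedAddCommGroup F] [NormedSpace ℂ F]
  (E : M → Type*) [∀ x, AddCommGroup (E x)] [∀ x, Module ℂ (E x)]
  [TopologicalSpace (TotalSpace F E)] [∀ x, TopologicalSpace (E x)]
  [FiberBundle F E] [VectorBundle ℂ F E]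

/-- A smooth Hermitian metric on the complex vector bundle `E`: a positive definite Hermitian form
on each fibre (conjugate linear in the first variable), such that in each of the bundle's local
trivializations the coefficients `h(v, w)`, with `v`, `w` constant, are smooth functions
(in the real sense). -/
structure SmoothHermitianMetric where
  form : ∀ x : M, E x →ₗ⋆[ℂ] E x →ₗ[ℂ] ℂ
  conj_symm : ∀ (x : M) (v w : E x), star (form x v w) = form x w v
  pos : ∀ (x : M) (v : E x), v ≠ 0 → 0 < (form x v v).re
  smooth : ∀ (e : Trivialization F (π F E)) [MemTrivializationAtlas e] (v w : F),
    ContMDiffOn 𝓘(ℝ, ℂ) 𝓘(ℝ, ℂ) ∞ (fun x => form x (e.symm x v) (e.symm x w)) e.baseSet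

variable {F E}

/-- A section `s` of `E` over the open set `D` is holomorphic: it is a holomorphic map from the
open submanifold `D` to the total space. -/
def IsHolomorphicSection (F : Type*) [NormedAddCommGroup F] [NormedSpace ℂ F]
    {E : M → Type*} [TopologicalSpace (TotalSpace F E)] [∀ x, TopologicalSpace (E x)]
    [FiberBundle F E] {D : Opens M} (s : ∀ x : D, E x) : Prop :=
  ContMDiff 𝓘(ℂ, ℂ) (𝓘(ℂ, ℂ).prod 𝓘(ℂ, F)) ω
    (fun x : D => (⟨(x : M), s x⟩ : TotalSpace F E))

/-- `‖s‖² = ∫_D h(s, s) dV ∈ [0, ∞]` for a section `s` of `E` over `D`. -/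
noncomputable def normSqL2 [MeasurableSpace M] (h : SmoothHermitianMetric F E) (μ : Measure M)
    {D : Opens M} (s : ∀ x : D, E x) : ℝ≥0∞ :=
  ∫⁻ x : D, ENNReal.ofReal (h.form x (s x) (s x)).re ∂(μ.comap (Subtype.val : D → M))

theorem SmoothHermitianMetric.re_nonneg (h : SmoothHermitianMetric F E) (x : M) (v : E x) :
    0 ≤ (h.form x v v).re := by
  by_cases hv : v = 0
  · simp [hv]
  · exact (h.pos x v hv).le

theorem SmoothHermitianMetric.re_add_le (h : SmoothHermitianMetric F E) (x : M) (v w : E x) :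
    (h.form x (v + w) (v + w)).re ≤ 2 * (h.form x v v).re + 2 * (h.form x w w).re := by
  have := h.re_nonneg x (v - w)
  simp only [map_add, map_sub, LinearMap.add_apply, LinearMap.sub_apply, Complex.add_re,
    Complex.sub_re] at this ⊢
  linarith

theorem IsHolomorphicSection.add {D : Opens M} {s t : ∀ x : D, E x}
    (hs : IsHolomorphicSection F s) (ht : IsHolomorphicSection F t) :
    IsHolomorphicSection F (s + t) := by
  intro x
  have h1 := contMDiffAt_totalSpace.1 (hs x)
  have h2 := contMDiffAt_totalSpace.1 (ht x)
  refine contMDiffAt_totalSpace.2 ⟨h1.1, (h1.2.add h2.2).congr_of_eventuallyEq ?_⟩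
  have hb : ∀ᶠ y : D in 𝓝 x, (y : M) ∈ (trivializationAt F E (x : M)).baseSet :=
    continuous_subtype_val.continuousAt.preimage_mem_nhds
      ((trivializationAt F E (x : M)).open_baseSet.mem_nhds
        (FiberBundle.mem_baseSet_trivializationAt' (x : M)))
  filter_upwards [hb] with y hy
  exact ((trivializationAt F E (x : M)).linear ℂ hy).1 _ _

theorem IsHolomorphicSection.smul {D : Opens M} {s : ∀ x : D, E x}
    (hs : IsHolomorphicSection F s) (c : ℂ) : IsHolomorphicSection F (c • s) := by
  intro x
  have h1 := contMDiffAt_totalSpace.1 (hs x)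
  have hc : ContMDiffAt 𝓘(ℂ, ℂ) 𝓘(ℂ, ℂ) ω (fun _ : D => c) x := contMDiffAt_const
  refine contMDiffAt_totalSpace.2 ⟨h1.1, (hc.smul h1.2).congr_of_eventuallyEq ?_⟩
  have hb : ∀ᶠ y : D in 𝓝 x, (y : M) ∈ (trivializationAt F E (x : M)).baseSet :=
    continuous_subtype_val.continuousAt.preimage_mem_nhds
      ((trivializationAt F E (x : M)).open_baseSet.mem_nhds
        (FiberBundle.mem_baseSet_trivializationAt' (x : M)))
  filter_upwards [hb] with y hy
  exact ((trivializationAt F E (x : M)).linear ℂ hy).2 _ _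

theorem IsHolomorphicSection.zero {D : Opens M} :
    IsHolomorphicSection F (0 : ∀ x : D, E x) := by
  intro x
  have hv : ContMDiff 𝓘(ℂ, ℂ) 𝓘(ℂ, ℂ) ω (Subtype.val : D → M) := contMDiff_subtype_val
  refine contMDiffAt_totalSpace.2 ⟨hv x,
    (contMDiffAt_const (c := (0 : F))).congr_of_eventuallyEq ?_⟩
  have hb : ∀ᶠ y : D in 𝓝 x, (y : M) ∈ (trivializationAt F E (x : M)).baseSet :=
    continuous_subtype_val.continuousAt.preimage_mem_nhds
      ((trivializationAt F E (x : M)).open_baseSet.mem_nhds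
        (FiberBundle.mem_baseSet_trivializationAt' (x : M)))
  filter_upwards [hb] with y hy
  exact ((trivializationAt F E (x : M)).linear ℂ hy).map_zero

/-- The function `h(s, s)` is continuous for a holomorphic section `s`. -/
theorem IsHolomorphicSection.continuous_normSq [FiniteDimensional ℂ F]
    (h : SmoothHermitianMetric F E) {D : Opens M} {s : ∀ x : D, E x}
    (hs : IsHolomorphicSection F s) :
    Continuous fun x : D => (h.form x (s x) (s x)).re := by
  refine continuous_iff_continuousAt.2 fun x => ?_
  set e := trivializationAt F E (x : M) with he
  have hx : (x : M) ∈ e.baseSet := FiberBundle.mem_baseSet_trivializationAt' (x : M)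
  have hcoord : ContinuousAt (fun y : D => (e ⟨(y : M), s y⟩).2) x :=
    (contMDiffAt_totalSpace.1 (hs x)).2.continuousAt
  have hb : ∀ᶠ y : D in 𝓝 x, (y : M) ∈ e.baseSet :=
    continuous_subtype_val.continuousAt.preimage_mem_nhds (e.open_baseSet.mem_nhds hx)
  let b := Module.finBasis ℂ F
  have hrepr : ∀ i, ContinuousAt (fun y : D => b.repr (e ⟨(y : M), s y⟩).2 i) x := fun i =>
    ((b.coord i).continuous_of_finiteDimensional.continuousAt).comp hcoord
  have hcoef : ∀ i j, ContinuousAt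
      (fun y : D => h.form y (e.symm y (b i)) (e.symm y (b j))) x := fun i j =>
    ((h.smooth e (b i) (b j)).continuousOn.continuousAt (e.open_baseSet.mem_nhds hx)).comp
      (f := (Subtype.val : D → M)) continuous_subtype_val.continuousAt
  have hsum : ContinuousAt (fun y : D => (∑ i, ∑ j,
      star (b.repr (e ⟨(y : M), s y⟩).2 i) * (b.repr (e ⟨(y : M), s y⟩).2 j *
        h.form y (e.symm y (b i)) (e.symm y (b j)))).re) x := by
    refine Complex.continuous_re.continuousAt.comp ?_
    refine tendsto_finsetSum _ fun i _ => tendsto_finsetSum _ fun j _ => ?_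
    exact (continuous_star.continuousAt.comp (hrepr i)).mul ((hrepr j).mul (hcoef i j))
  refine hsum.congr ?_
  filter_upwards [hb] with y hy
  have hsy : s y = ∑ i, b.repr (e ⟨(y : M), s y⟩).2 i • e.symm y (b i) := by
    have h1 : s y = e.symmₗ ℂ (y : M) (e ⟨(y : M), s y⟩).2 := by
      rw [Trivialization.symmₗ_apply _ hy]
      exact (e.symm_apply_apply_mk hy (s y)).symm
    conv_lhs => rw [h1, ← b.sum_repr (e ⟨(y : M), s y⟩).2]
    rw [map_sum]
    refine Finset.sum_congr rfl fun i _ => ?_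
    rw [map_smul, Trivialization.symmₗ_apply _ hy]
  congr 1
  conv_rhs => rw [hsy]
  simp only [map_sum, LinearMap.sum_apply, map_smulₛₗ, LinearMap.smul_apply, smul_eq_mul,
    Finset.mul_sum, RingHom.id_apply]
  rw [Finset.sum_comm]
  refine Finset.sum_congr rfl fun i _ => Finset.sum_congr rfl fun j _ => ?_
  rw [starRingEnd_apply]
  ring

variable [MeasurableSpace M] [BorelSpace M] [FiniteDimensional ℂ F]

/-- The space `𝒪L²(E|_D)` of holomorphic sections `s` of `E` over `D` with
`∫_D h(s, s) dV < ∞`. -/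
noncomputable def holomorphicL2 (h : SmoothHermitianMetric F E) (μ : Measure M) (D : Opens M) :
    Submodule ℂ (∀ x : D, E x) where
  carrier := {s | IsHolomorphicSection F s ∧ normSqL2 h μ s < ⊤}
  zero_mem' := ⟨IsHolomorphicSection.zero, by simp [normSqL2]⟩
  add_mem' := by
    rintro s t ⟨hs, hs'⟩ ⟨ht, ht'⟩
    refine ⟨hs.add ht, ?_⟩
    have hle : normSqL2 h μ (s + t) ≤ 2 * normSqL2 h μ s + 2 * normSqL2 h μ t := by
      have hm := (hs.continuous_normSq h).measurable.ennreal_ofReal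
      have hm' := (ht.continuous_normSq h).measurable.ennreal_ofReal
      unfold normSqL2
      rw [← lintegral_const_mul _ hm, ← lintegral_const_mul _ hm',
        ← lintegral_add_left (hm.const_mul 2)]
      refine lintegral_mono fun x => ?_
      refine (ENNReal.ofReal_le_ofReal (h.re_add_le x (s x) (t x))).trans_eq ?_
      have hp := h.re_nonneg x (s x)
      have hq := h.re_nonneg x (t x)
      rw [ENNReal.ofReal_add (by positivity) (by positivity), ENNReal.ofReal_mul (by norm_num),
        ENNReal.ofReal_mul (by norm_num)]
      simp
    exact hle.trans_lt (ENNReal.add_lt_top.2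
      ⟨ENNReal.mul_lt_top (by simp) hs', ENNReal.mul_lt_top (by simp) ht'⟩)
  smul_mem' := by
    rintro c s ⟨hs, hs'⟩
    refine ⟨hs.smul c, ?_⟩
    have heq : normSqL2 h μ (c • s) = ENNReal.ofReal (Complex.normSq c) * normSqL2 h μ s := by
      unfold normSqL2
      rw [← lintegral_const_mul _ (hs.continuous_normSq h).measurable.ennreal_ofReal]
      refine lintegral_congr fun x => ?_
      rw [← ENNReal.ofReal_mul (Complex.normSq_nonneg c)]
      congr 1
      simp only [Pi.smul_apply, map_smulₛₗ, LinearMap.smul_apply, smul_eq_mul, RingHom.id_apply]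
      rw [← mul_assoc, Complex.mul_conj, Complex.re_ofReal_mul]
    rw [heq]
    exact ENNReal.mul_lt_top ENNReal.ofReal_lt_top hs'

end Sections

/-! ### Subharmonic functions in the plane -/

/-! In a chart and a trivialization near a point of `K`, the metric and the volume are comparable
with the flat ones. It therefore suffices to extend an `L²` function `f` that is holomorphic off a
closed set on which a subharmonic `φ ≢ -∞` equals `-∞`. The point is that `∂̄f = 0` weakly across
this set, and the cutoffs that show it are made from `φ` itself.

Let `m` bound `φ` from above. Then `u = exp (k (φ - m))` is subharmonic with values in `[0, 1]`,
vanishes on `K`, and tends to `1` almost everywhere as `k → 0`. Since `2|∇u|² ≤ Δ(u²) = -Δ(1 - u²)`,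
integration by parts against a fixed cutoff bounds the Dirichlet energy of `u` by a multiple of `∫
(1 - u)`, which tends to `0`. The function `η = max 0 (2u - 1)` vanishes near `K` because `φ` is
upper semicontinuous, so `∂̄f = 0` may be tested against `ηχ`. The error terms contain `∂̄η` or `1 -
η` and are small by Cauchy-Schwarz, because `f` is in `L²`.

As `u` need not be smooth, derivatives are replaced by circle means of radius `r`: `∂̄χ` by `∫
e^{iθ} χ(w + r e^{iθ}) dθ`, which is `2πr ∂̄χ + o(r)` for smooth `χ`, the Laplacian by mean minus
value, and integration by parts by translation invariance of Lebesgue measure. This gives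
`IsDiskWeight.energy_le` and `IsSubharmonicOnPlane.norm_integral_circle_le`.

The rest is the proof of Weyl's lemma. Mollifications of `f` by radial kernels are holomorphic, and
by the mean value property they equal `f` where the disk of mollification avoids `K`. By the
identity theorem they do not depend on the radius, so any one of them is the extension
(`IsSubharmonicOnPlane.exists_holomorphic_extension`).

Finally, `φ` is finite almost everywhere, so `D` is dense. Hence local extensions agree and glue,
and the extension is unique. Conversely, global sections are bounded on the compact `M`, so their
restrictions are `L²`. -/

theorem UpperSemicontinuousOn.measurable_piecewise {X : Type*} [TopologicalSpace X]
    [MeasurableSpace X] [OpensMeasurableSpace X] {u : X → EReal} {S : Set X}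
    [∀ x, Decidable (x ∈ S)] (hu : UpperSemicontinuousOn u S) (hS : MeasurableSet S) (a : EReal) :
    Measurable (S.piecewise u fun _ => a) := by
  refine measurable_of_Iio fun b => ?_
  obtain ⟨V, hV, hVe⟩ := upperSemicontinuousOn_iff_preimage_Iio.1 hu b
  rw [piecewise_preimage, Set.ite, inter_comm, hVe]
  refine (hS.inter hV.measurableSet).union (MeasurableSet.diff ?_ hS)
  exact measurableSet_Iio.preimage measurable_const

/-- Circle means use angles in `(0, 2π]`, polar coordinates use `(-π, π)`; this passes from the
first to the second. -/
theorem ae_Ioo_of_ae_Ioc_of_periodic {p : ℝ → Prop} (hp : Function.Periodic p (2 * Real.pi))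
    (h : ∀ᵐ θ ∂volume.restrict (Ioc 0 (2 * Real.pi)), p θ) :
    ∀ᵐ θ ∂volume.restrict (Ioo (-Real.pi) Real.pi), p θ := by
  rw [ae_restrict_iff' measurableSet_Ioc] at h
  rw [ae_restrict_iff' measurableSet_Ioo]
  have h2 : ∀ᵐ θ : ℝ, θ + 2 * Real.pi ∈ Ioc 0 (2 * Real.pi) → p (θ + 2 * Real.pi) :=
    (measurePreserving_add_right volume (2 * Real.pi)).quasiMeasurePreserving.ae h
  filter_upwards [h, h2] with θ h1 h2 hθ
  rcases lt_or_ge 0 θ with h0 | h0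
  · exact h1 ⟨h0, by linarith [hθ.2, Real.pi_pos]⟩
  · rw [← hp θ]
    exact h2 ⟨by linarith [hθ.1, Real.pi_pos], by linarith⟩

/-- A measurable set that meets almost no point of each circle around `c` is a null set. -/
theorem ae_of_ae_circleMap {c : ℂ} {p : ℂ → Prop} (hp : MeasurableSet {z | p z})
    (h : ∀ r > 0, ∀ᵐ θ ∂volume.restrict (Ioc 0 (2 * Real.pi)), p (circleMap c r θ)) :
    ∀ᵐ z, p z := by
  set g : ℂ → ℝ≥0∞ := {z | ¬ p z}.indicator 1 with hg
  have hgm : Measurable g := measurable_one.indicator hp.compl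
  suffices hint : ∫⁻ z, g z = 0 by
    rw [hg, lintegral_indicator_one (s := {z | ¬ p z}) hp.compl] at hint
    exact hint
  rw [← lintegral_add_left_eq_self g c, ← Complex.lintegral_comp_polarCoord_symm]
  have hsymm : ∀ q : ℝ × ℝ, c + Complex.polarCoord.symm q = circleMap c q.1 q.2 := by
    intro q
    rw [circleMap, Complex.polarCoord_symm_apply, Complex.exp_mul_I, Complex.ofReal_cos,
      Complex.ofReal_sin]
  simp only [hsymm]
  have hcm : Measurable fun q : ℝ × ℝ => circleMap c q.1 q.2 := by
    unfold circleMap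
    fun_prop
  have hm : Measurable fun q : ℝ × ℝ => ENNReal.ofReal q.1 • g (circleMap c q.1 q.2) :=
    (measurable_fst.ennreal_ofReal).mul (hgm.comp hcm)
  rw [polarCoord_target, Measure.volume_eq_prod, setLIntegral_prod _ hm.aemeasurable]
  refine (setLIntegral_congr_fun measurableSet_Ioi fun r hr => ?_).trans (lintegral_zero)
  refine (lintegral_congr_ae ?_).trans lintegral_zero
  filter_upwards [ae_Ioo_of_ae_Ioc_of_periodic (p := fun θ => p (circleMap c r θ))
    (fun θ => by simp only [periodic_circleMap c r θ]) (h r hr)] with θ hθ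
  simp [hg, hθ]

theorem volume_restrict_Ioc_two_pi_univ :
    (volume.restrict (Ioc 0 (2 * Real.pi))) univ = ENNReal.ofReal (2 * Real.pi) := by
  simp

namespace IsSubharmonicOnPlane

variable {φ : ℂ → EReal} {Ω : Set ℂ} {c : ℂ} {r : ℝ}

theorem measurable_circle (hφ : IsSubharmonicOnPlane φ Ω) (hr : 0 < r)
    (hb : Metric.closedBall c r ⊆ Ω) : Measurable fun θ => φ (circleMap c r θ) := by
  classical
  have h1 := (hφ.1.mono hb).measurable_piecewise Metric.isClosed_closedBall.measurableSet 0
  have h2 : (fun θ => φ (circleMap c r θ)) =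
      (fun θ => (Metric.closedBall c r).piecewise φ (fun _ => 0) (circleMap c r θ)) := by
    ext θ
    rw [piecewise_eq_of_mem]
    exact circleMap_mem_closedBall c hr.le θ
  rw [h2]
  exact h1.comp (continuous_circleMap c r).measurable

/-- If the negative part had infinite mean, `circleMean` would be `⊥` whatever the positive part,
because `x - ⊤ = ⊥` in `EReal`. This contradicts the sub-mean value inequality at a point where `φ`
is finite. -/
theorem lintegral_neg_lt_top (hφ : IsSubharmonicOnPlane φ Ω) (hr : 0 < r)
    (hb : Metric.closedBall c r ⊆ Ω) (hc : φ c ≠ ⊥) :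
    ∫⁻ θ in Ioc 0 (2 * Real.pi), (-φ (circleMap c r θ)).toENNReal < ⊤ := by
  by_contra! htop
  have hle := hφ.2.2 c r hr hb
  have h2 : laverage (volume.restrict (Ioc 0 (2 * Real.pi)))
      (fun θ => (-φ (circleMap c r θ)).toENNReal) = ⊤ := by
    rw [laverage_eq, top_le_iff.1 htop, volume_restrict_Ioc_two_pi_univ,
      ENNReal.top_div_of_ne_top ENNReal.ofReal_ne_top]
  rw [circleMean, h2, EReal.coe_ennreal_top, EReal.sub_top] at hle
  exact hc (le_bot_iff.1 hle)

theorem ae_circle_ne_bot (hφ : IsSubharmonicOnPlane φ Ω) (hr : 0 < r)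
    (hb : Metric.closedBall c r ⊆ Ω) (hc : φ c ≠ ⊥) :
    ∀ᵐ θ ∂volume.restrict (Ioc 0 (2 * Real.pi)), φ (circleMap c r θ) ≠ ⊥ := by
  filter_upwards [ae_lt_top (hφ.measurable_circle hr hb).neg.ereal_toENNReal
    (hφ.lintegral_neg_lt_top hr hb hc).ne] with θ hθ hbot
  simp [hbot] at hθ

/-- A subharmonic function which is finite at `c` is finite almost everywhere in each disk around
`c`. -/
theorem ae_ne_bot (hφ : IsSubharmonicOnPlane φ Ω) (hb : Metric.closedBall c r ⊆ Ω)
    (hc : φ c ≠ ⊥) : ∀ᵐ z, z ∈ Metric.ball c r → φ z ≠ ⊥ := by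
  classical
  have h1 := (hφ.1.mono hb).measurable_piecewise Metric.isClosed_closedBall.measurableSet 0
  refine ae_of_ae_circleMap (c := c) ?_ fun ρ hρ => ?_
  · have : {z | z ∈ Metric.ball c r → φ z ≠ ⊥} = (Metric.ball c r)ᶜ ∪
        {z | (Metric.closedBall c r).piecewise φ (fun _ => 0) z ≠ ⊥} := by
      ext z
      by_cases hz : z ∈ Metric.closedBall c r
      · simp only [mem_ofPred_eq, mem_union, mem_compl_iff, piecewise_eq_of_mem _ _ _ hz]
        tauto
      · have hz' : z ∉ Metric.ball c r := fun h => hz (Metric.ball_subset_closedBall h)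
        simp only [mem_ofPred_eq, mem_union, mem_compl_iff, hz', not_false_eq_true, true_or,
          false_imp_iff]
    rw [this]
    exact Metric.isOpen_ball.measurableSet.compl.union
      (h1 (measurableSet_singleton (⊥ : EReal)).compl)
  · rcases lt_or_ge ρ r with h | h
    · filter_upwards [hφ.ae_circle_ne_bot hρ ((Metric.closedBall_subset_closedBall h.le).trans hb)
        hc] with θ hθ _ using hθ
    · refine Eventually.of_forall fun θ hθ => ?_
      rw [Metric.mem_ball, dist_eq_norm, circleMap_sub_center, norm_circleMap_zero,
        abs_of_pos hρ] at hθ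
      exact absurd h hθ.not_ge

/-- Translation of the `EReal`-valued sub-mean value inequality into real integrals. The bound `m`
makes the positive part integrable, and finiteness at the centre does so for the negative part. -/
theorem integrable_and_le (hφ : IsSubharmonicOnPlane φ Ω) (hr : 0 < r)
    (hb : Metric.closedBall c r ⊆ Ω) (hc : φ c ≠ ⊥) {m : ℝ}
    (hm : ∀ z ∈ Metric.closedBall c r, φ z ≤ m) :
    IntegrableOn (fun θ => (φ (circleMap c r θ)).toReal) (Ioc 0 (2 * Real.pi)) ∧
    2 * Real.pi * (φ c).toReal ≤ ∫ θ in Ioc 0 (2 * Real.pi), (φ (circleMap c r θ)).toReal := by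
  have hmeas := hφ.measurable_circle hr hb
  have hN := hφ.lintegral_neg_lt_top hr hb hc
  have hPm := hmeas.ereal_toENNReal
  have hNm : Measurable fun θ => (-φ (circleMap c r θ)).toENNReal :=
    hmeas.neg.ereal_toENNReal
  have hP : ∫⁻ θ in Ioc 0 (2 * Real.pi), (φ (circleMap c r θ)).toENNReal < ⊤ := by
    refine (lintegral_mono (g := fun _ => (m : EReal).toENNReal) fun θ =>
      EReal.toENNReal_le_toENNReal (hm _ (circleMap_mem_closedBall c hr.le θ))).trans_lt ?_
    rw [lintegral_const]
    exact ENNReal.mul_lt_top (by simp [EReal.toENNReal])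
      (by rw [volume_restrict_Ioc_two_pi_univ]; exact ENNReal.ofReal_lt_top)
  have hPi := integrable_toReal_of_lintegral_ne_top hPm.aemeasurable hP.ne
  have hNi := integrable_toReal_of_lintegral_ne_top hNm.aemeasurable hN.ne
  have hae : (fun θ => (φ (circleMap c r θ)).toENNReal.toReal -
      (-φ (circleMap c r θ)).toENNReal.toReal) =ᵐ[volume.restrict (Ioc 0 (2 * Real.pi))]
      fun θ => (φ (circleMap c r θ)).toReal := by
    filter_upwards [hφ.ae_circle_ne_bot hr hb hc] with θ hθ
    have htop : φ (circleMap c r θ) ≠ ⊤ := hφ.2.1 _ (hb (circleMap_mem_closedBall c hr.le θ))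
    lift φ (circleMap c r θ) to ℝ using ⟨htop, hθ⟩ with x
    rw [← EReal.coe_neg, EReal.toENNReal_of_ne_top (EReal.coe_ne_top _),
      EReal.toENNReal_of_ne_top (EReal.coe_ne_top _)]
    simp only [EReal.toReal_coe, ENNReal.toReal_ofReal']
    rcases le_total x 0 with h | h
    · rw [max_eq_right h, max_eq_left (by linarith)]; ring
    · rw [max_eq_left h, max_eq_right (by linarith)]; ring
  refine ⟨(hPi.sub hNi).congr hae, ?_⟩
  rw [← integral_congr_ae hae, integral_sub hPi hNi]
  have hle := hφ.2.2 c r hr hb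
  rw [circleMean, laverage_eq, laverage_eq, volume_restrict_Ioc_two_pi_univ] at hle
  have h2p : 0 < 2 * Real.pi := Real.two_pi_pos
  have key : ∀ A : ℝ≥0∞, A < ⊤ → (((A / ENNReal.ofReal (2 * Real.pi) : ℝ≥0∞)) : EReal) =
      ((A.toReal / (2 * Real.pi) : ℝ) : EReal) := by
    intro A hA
    rw [← EReal.coe_toReal (x := ((A / ENNReal.ofReal (2 * Real.pi) : ℝ≥0∞) : EReal)),
      EReal.toReal_coe_ennreal, ENNReal.toReal_div, ENNReal.toReal_ofReal h2p.le]
    · simpa using (ENNReal.div_lt_top hA.ne (by simpa using Real.pi_pos)).ne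
    · exact EReal.coe_ennreal_ne_bot _
  rw [key _ hP, key _ hN, ← EReal.coe_sub,
    ← EReal.coe_toReal (hφ.2.1 c (hb (Metric.mem_closedBall_self hr.le))) hc,
    EReal.coe_le_coe_iff, ← sub_div, le_div_iff₀ h2p] at hle
  rw [integral_toReal hPm.aemeasurable (ae_lt_top hPm hP.ne),
    integral_toReal hNm.aemeasurable (ae_lt_top hNm hN.ne)]
  linarith

end IsSubharmonicOnPlane

/-! ### An energy estimate for functions with the sub-mean value property -/

/-- The measure `dθ` on the circle. -/
noncomputable def angleMeasure : Measure ℝ := volume.restrict (Ioc 0 (2 * Real.pi))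

instance : IsFiniteMeasure angleMeasure := by
  unfold angleMeasure
  infer_instance

theorem angleMeasure_real_univ : angleMeasure.real univ = 2 * Real.pi := by
  rw [angleMeasure, measureReal_def, volume_restrict_Ioc_two_pi_univ,
    ENNReal.toReal_ofReal Real.two_pi_pos.le]

theorem integral_angleMeasure {G : Type*} [NormedAddCommGroup G] [NormedSpace ℝ G] (f : ℝ → G) :
    ∫ θ, f θ ∂angleMeasure = ∫ θ in 0..2 * Real.pi, f θ :=
  (intervalIntegral.integral_of_le Real.two_pi_pos.le).symm

theorem integral_exp_mul_I_angleMeasure :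
    ∫ θ, Complex.exp (θ * Complex.I) ∂angleMeasure = 0 := by
  rw [integral_angleMeasure]
  have h := integral_exp_mul_complex (a := 0) (b := 2 * Real.pi) Complex.I_ne_zero
  simp_rw [mul_comm Complex.I] at h
  rw [h]
  simp [Complex.exp_two_pi_mul_I]

theorem measurable_circleMap_prod (r : ℝ) : Measurable fun p : ℝ × ℂ => circleMap p.2 r p.1 := by
  unfold circleMap
  fun_prop

theorem circleMap_eq_add (c : ℂ) (r θ : ℝ) : circleMap c r θ = c + circleMap 0 r θ := by
  simp [circleMap]

/-- For each fixed angle this is a translation of the plane. It replaces integration by parts: a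
shift by `r e^{iθ}` moves from one factor of an integrand to the other. -/
theorem measurePreserving_circleMap_prod (r : ℝ) :
    MeasurePreserving (fun p : ℝ × ℂ => (p.1, circleMap p.2 r p.1))
      (angleMeasure.prod volume) (angleMeasure.prod volume) := by
  refine MeasurePreserving.skew_product (g := fun θ w => circleMap w r θ)
    (MeasurePreserving.id angleMeasure) (measurable_circleMap_prod r) (Eventually.of_forall fun θ => ?_)
  have : (fun w => circleMap w r θ) = fun w => w + circleMap 0 r θ :=
    funext fun w => circleMap_eq_add w r θ
  rw [this]
  exact map_add_right_eq_self volume _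

theorem integrable_prod_of_norm_le {G : Type*} [NormedAddCommGroup G] {g : ℝ × ℂ → G} {b : ℂ → ℝ}
    (hg : AEStronglyMeasurable g (angleMeasure.prod volume)) (hb : Integrable b)
    (h : ∀ θ w, ‖g (θ, w)‖ ≤ b w) : Integrable g (angleMeasure.prod volume) :=
  (hb.comp_snd angleMeasure).mono' hg (Eventually.of_forall fun p => h p.1 p.2)

/-- A measurable function `0 ≤ u ≤ 1` which is `1` outside a disk of radius `7a`, and which has the
sub-mean value property for the small disks with centre in a disk of radius `6a`. -/
structure IsDiskWeight (u : ℂ → ℝ) (z₀ : ℂ) (a : ℝ) : Prop where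
  measurable : Measurable u
  nonneg : ∀ w, 0 ≤ u w
  le_one : ∀ w, u w ≤ 1
  eq_one : ∀ w ∉ Metric.closedBall z₀ (7 * a), u w = 1
  submean : ∀ c ∈ Metric.closedBall z₀ (6 * a), ∀ r, 0 < r → r < a →
    2 * Real.pi * u c ≤ ∫ θ, u (circleMap c r θ) ∂angleMeasure

/-- The quadratic cutoff `max 0 (ρ² - |w - z₀|²)`. -/
noncomputable def quadCutoff (z₀ : ℂ) (ρ : ℝ) (w : ℂ) : ℝ := max 0 (ρ ^ 2 - ‖w - z₀‖ ^ 2)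

theorem continuous_quadCutoff (z₀ : ℂ) (ρ : ℝ) : Continuous (quadCutoff z₀ ρ) := by
  unfold quadCutoff
  fun_prop

theorem quadCutoff_nonneg (z₀ : ℂ) (ρ : ℝ) (w : ℂ) : 0 ≤ quadCutoff z₀ ρ w := le_max_left _ _

theorem quadCutoff_le (z₀ : ℂ) (ρ : ℝ) (w : ℂ) : quadCutoff z₀ ρ w ≤ ρ ^ 2 :=
  max_le (sq_nonneg _) (by linarith [sq_nonneg ‖w - z₀‖])

theorem quadCutoff_eq_zero {z₀ : ℂ} {ρ : ℝ} (hρ : 0 ≤ ρ) {w : ℂ}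
    (hw : w ∉ Metric.closedBall z₀ ρ) : quadCutoff z₀ ρ w = 0 := by
  rw [Metric.mem_closedBall, dist_eq_norm, not_le] at hw
  exact max_eq_left (by nlinarith [norm_nonneg (w - z₀)])

/-- A discrete form of `Δζ ≥ -4`. Where the cutoff vanishes at `w`, the integrand is nonpositive.
Elsewhere the cutoff equals the quadratic at `w` and dominates it on the circle; in the expansion of
the square the cross term has mean zero, which leaves `r²`. -/
theorem quadCutoff_sub_mean_le (z₀ : ℂ) (ρ : ℝ) (w : ℂ) (r : ℝ) :
    ∫ θ, (quadCutoff z₀ ρ w - quadCutoff z₀ ρ (w - circleMap 0 r θ)) ∂angleMeasure ≤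
      2 * Real.pi * r ^ 2 := by
  have hcont : Continuous fun θ => quadCutoff z₀ ρ (w - circleMap 0 r θ) :=
    (continuous_quadCutoff z₀ ρ).comp (continuous_const.sub (continuous_circleMap 0 r))
  have hint : ∀ {G : Type} [NormedAddCommGroup G] {g : ℝ → G}, Continuous g →
      Integrable g angleMeasure := fun hg => (hg.integrableOn_Icc).mono_set Ioc_subset_Icc_self
  rcases le_total (ρ ^ 2 - ‖w - z₀‖ ^ 2) 0 with h | h
  · refine (integral_nonpos fun θ => ?_).trans (by positivity)
    have : quadCutoff z₀ ρ w = 0 := max_eq_left h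
    simp only [this, zero_sub, Pi.zero_apply, Left.neg_nonpos_iff]
    exact quadCutoff_nonneg _ _ _
  · set x := w - z₀
    have hle : ∀ θ : ℝ, quadCutoff z₀ ρ w - quadCutoff z₀ ρ (w - circleMap 0 r θ) ≤
        r ^ 2 - (2 * r * ((starRingEnd ℂ) x * Complex.exp (θ * Complex.I))).re := by
      intro θ
      have h1 : quadCutoff z₀ ρ w = ρ ^ 2 - ‖x‖ ^ 2 := max_eq_right h
      have h2 : ρ ^ 2 - ‖w - circleMap 0 r θ - z₀‖ ^ 2 ≤ quadCutoff z₀ ρ (w - circleMap 0 r θ) :=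
        le_max_right _ _
      have h3 : w - circleMap 0 r θ - z₀ = x - circleMap 0 r θ := by ring
      have h4 : ‖x - circleMap 0 r θ‖ ^ 2 = ‖x‖ ^ 2 + r ^ 2 -
          (2 * r * ((starRingEnd ℂ) x * Complex.exp (θ * Complex.I))).re := by
        have h5 : ‖circleMap 0 r θ‖ ^ 2 = r ^ 2 := by rw [norm_circleMap_zero, sq_abs]
        rw [← h5, ← Complex.normSq_eq_norm_sq, ← Complex.normSq_eq_norm_sq,
          ← Complex.normSq_eq_norm_sq, Complex.normSq_sub]
        congr 1
        rw [← Complex.conj_re]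
        simp [circleMap]
        ring
      rw [h3, h4] at h2
      linarith
    refine (integral_mono ((integrable_const _).sub (hint hcont)) ?_ hle).trans_eq ?_
    · exact hint (by fun_prop)
    · rw [integral_sub (integrable_const _) (hint (by fun_prop)), integral_const,
        angleMeasure_real_univ]
      have h6 : ∫ θ : ℝ, (2 * r * ((starRingEnd ℂ) x * Complex.exp (θ * Complex.I))).re
          ∂angleMeasure = 0 := by
        have := integral_re (𝕜 := ℂ) (μ := angleMeasure)
          (f := fun θ : ℝ => 2 * r * ((starRingEnd ℂ) x * Complex.exp (θ * Complex.I)))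
          (hint (by fun_prop))
        simp only [RCLike.re_to_complex] at this
        rw [this, integral_const_mul, integral_const_mul, integral_exp_mul_I_angleMeasure]
        simp
      rw [h6, smul_eq_mul, sub_zero]

namespace IsDiskWeight

variable {u : ℂ → ℝ} {z₀ : ℂ} {a : ℝ}

theorem integrable_one_sub (hu : IsDiskWeight u z₀ a) : Integrable fun w => 1 - u w := by
  have h : Integrable ((Metric.closedBall z₀ (7 * a)).indicator fun _ => (1 : ℝ)) :=
    (integrable_indicator_iff Metric.isClosed_closedBall.measurableSet).2
      (integrableOn_const (isCompact_closedBall _ _).measure_lt_top.ne)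
  refine h.mono' (measurable_const.sub hu.measurable).aestronglyMeasurable
    (Eventually.of_forall fun w => ?_)
  rw [Real.norm_of_nonneg (by linarith [hu.le_one w])]
  by_cases hw : w ∈ Metric.closedBall z₀ (7 * a)
  · rw [indicator_of_mem hw]; linarith [hu.nonneg w]
  · rw [indicator_of_notMem hw, hu.eq_one w hw, sub_self]

theorem integrable_energy (hu : IsDiskWeight u z₀ a) (ha : 0 < a) (r : ℝ) :
    Integrable (fun p : ℝ × ℂ =>
      quadCutoff z₀ (6 * a) p.2 * (u (circleMap p.2 r p.1) - u p.2) ^ 2)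
      (angleMeasure.prod volume) := by
  have hu' := hu.measurable
  have hζ : Integrable (quadCutoff z₀ (6 * a)) :=
    (continuous_quadCutoff z₀ (6 * a)).integrable_of_hasCompactSupport
      (HasCompactSupport.intro (isCompact_closedBall z₀ (6 * a)) fun w hw =>
        quadCutoff_eq_zero (by linarith) hw)
  refine integrable_prod_of_norm_le ?_ hζ fun θ w => ?_
  · exact (((continuous_quadCutoff z₀ (6 * a)).measurable.comp measurable_snd).mul
      (((hu'.comp (measurable_circleMap_prod r)).sub
        (hu'.comp measurable_snd)).pow_const 2)).aestronglyMeasurable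
  · have h0 := quadCutoff_nonneg z₀ (6 * a) w
    rw [Real.norm_of_nonneg (by positivity)]
    refine mul_le_of_le_one_right h0 ?_
    rw [sq_le_one_iff_abs_le_one, abs_le]
    constructor <;> linarith [hu.nonneg w, hu.le_one w, hu.nonneg (circleMap w r θ),
      hu.le_one (circleMap w r θ)]

/-- A Caccioppoli inequality in finite differences. By the sub-mean value property, the mean of `(u'
- u)²` over a circle is at most that of `u'² - u² = q - q'`, where `q = 1 - u²`. The shift is then
moved from `q` to the cutoff, whose mean drop is at most of order `r²`, and `q ≤ 2(1 - u)`. -/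
theorem energy_le (hu : IsDiskWeight u z₀ a) {r : ℝ} (hr : 0 < r) (hra : r < a) :
    ∫ p : ℝ × ℂ, quadCutoff z₀ (6 * a) p.2 * (u (circleMap p.2 r p.1) - u p.2) ^ 2
      ∂(angleMeasure.prod volume) ≤ 4 * Real.pi * r ^ 2 * ∫ w, (1 - u w) := by
  have ha : 0 < a := hr.trans hra
  have hu' := hu.measurable
  set ζ := quadCutoff z₀ (6 * a) with hζdef
  have hζm : Measurable ζ := (continuous_quadCutoff z₀ (6 * a)).measurable
  set q : ℂ → ℝ := fun w => 1 - u w ^ 2 with hq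
  have hqm : Measurable q := measurable_const.sub (hu'.pow_const 2)
  have hq0 : ∀ w, 0 ≤ q w := fun w => by
    simp only [hq]; nlinarith [hu.nonneg w, hu.le_one w]
  have hq1 : ∀ w, q w ≤ 2 * (1 - u w) := fun w => by
    simp only [hq]; nlinarith [hu.nonneg w, hu.le_one w]
  have hqi : Integrable q := (hu.integrable_one_sub.const_mul 2).mono'
    hqm.aestronglyMeasurable (Eventually.of_forall fun w => by
      rw [Real.norm_of_nonneg (hq0 w)]; exact hq1 w)
  have hA : Integrable (fun p : ℝ × ℂ => ζ p.2 * q p.2) (angleMeasure.prod volume) := by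
    refine integrable_prod_of_norm_le (((hζm.mul hqm).comp measurable_snd).aestronglyMeasurable)
      (hqi.const_mul ((6 * a) ^ 2)) fun θ w => ?_
    rw [Real.norm_of_nonneg (mul_nonneg (quadCutoff_nonneg _ _ _) (hq0 w))]
    exact mul_le_mul_of_nonneg_right (quadCutoff_le _ _ _) (hq0 w)
  have hB : Integrable (fun p : ℝ × ℂ => ζ (p.2 - circleMap 0 r p.1) * q p.2)
      (angleMeasure.prod volume) := by
    refine integrable_prod_of_norm_le ?_ (hqi.const_mul ((6 * a) ^ 2)) fun θ w => ?_
    · refine ((hζm.comp ?_).mul (hqm.comp measurable_snd)).aestronglyMeasurable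
      exact measurable_snd.sub ((continuous_circleMap 0 r).measurable.comp measurable_fst)
    rw [Real.norm_of_nonneg (mul_nonneg (quadCutoff_nonneg _ _ _) (hq0 w))]
    exact mul_le_mul_of_nonneg_right (quadCutoff_le _ _ _) (hq0 w)
  have hΨ := measurePreserving_circleMap_prod r
  have hcomp : ((fun p : ℝ × ℂ => ζ (p.2 - circleMap 0 r p.1) * q p.2) ∘
      fun p : ℝ × ℂ => (p.1, circleMap p.2 r p.1)) =
      fun p : ℝ × ℂ => ζ p.2 * q (circleMap p.2 r p.1) := by
    ext p
    simp only [Function.comp_apply]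
    rw [circleMap_eq_add p.2 r p.1, add_sub_cancel_right]
  have hC : Integrable (fun p : ℝ × ℂ => ζ p.2 * q (circleMap p.2 r p.1))
      (angleMeasure.prod volume) := by
    rw [← hcomp]
    exact (hΨ.integrable_comp hB.aestronglyMeasurable).2 hB
  have hBC : ∫ p : ℝ × ℂ, ζ p.2 * q (circleMap p.2 r p.1) ∂(angleMeasure.prod volume) =
      ∫ p : ℝ × ℂ, ζ (p.2 - circleMap 0 r p.1) * q p.2 ∂(angleMeasure.prod volume) := by
    rw [← hcomp]
    conv_rhs => rw [← hΨ.map_eq]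
    rw [integral_map hΨ.measurable.aemeasurable (by rw [hΨ.map_eq]; exact hB.aestronglyMeasurable)]
    rfl
  have hAC : Integrable (fun p : ℝ × ℂ => ζ p.2 * q p.2 - ζ p.2 * q (circleMap p.2 r p.1))
      (angleMeasure.prod volume) := hA.sub hC
  have hAB : Integrable (fun p : ℝ × ℂ => ζ p.2 * q p.2 - ζ (p.2 - circleMap 0 r p.1) * q p.2)
      (angleMeasure.prod volume) := hA.sub hB
  calc _ ≤ ∫ p : ℝ × ℂ, (ζ p.2 * q p.2 - ζ p.2 * q (circleMap p.2 r p.1))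
        ∂(angleMeasure.prod volume) := by
        rw [integral_prod_symm _ (hu.integrable_energy ha r), integral_prod_symm _ hAC]
        refine integral_mono (hu.integrable_energy ha r).integral_prod_right
          hAC.integral_prod_right fun w => ?_
        simp only
        by_cases hw : w ∈ Metric.closedBall z₀ (6 * a)
        · have hbd : ∀ {g : ℝ → ℝ}, Measurable g → (∀ θ, |g θ| ≤ 1) →
              Integrable g angleMeasure := fun hg hb =>
            (integrable_const (1 : ℝ)).mono' hg.aestronglyMeasurable (Eventually.of_forall hb)
          have hum : Measurable fun θ => u (circleMap w r θ) :=
            hu'.comp (continuous_circleMap w r).measurable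
          have hui : Integrable (fun θ => u (circleMap w r θ)) angleMeasure :=
            hbd hum fun θ => abs_le.2 ⟨by linarith [hu.nonneg (circleMap w r θ)], hu.le_one _⟩
          have hsub := hu.submean w hw r hr hra
          have hX : Integrable (fun θ => 2 * u w * (u (circleMap w r θ) - u w)) angleMeasure :=
            (hui.sub (integrable_const _)).const_mul _
          have hXn : 0 ≤ ∫ θ, 2 * u w * (u (circleMap w r θ) - u w) ∂angleMeasure := by
            rw [integral_const_mul, integral_sub hui (integrable_const _), integral_const,
              angleMeasure_real_univ, smul_eq_mul]
            exact mul_nonneg (mul_nonneg two_pos.le (hu.nonneg w)) (by linarith)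
          have hsq : Integrable (fun θ => (u (circleMap w r θ) - u w) ^ 2) angleMeasure := by
            refine hbd ((hum.sub measurable_const).pow_const 2) fun θ => ?_
            rw [abs_of_nonneg (sq_nonneg _), sq_le_one_iff_abs_le_one, abs_le]
            constructor <;> linarith [hu.nonneg w, hu.le_one w, hu.nonneg (circleMap w r θ),
              hu.le_one (circleMap w r θ)]
          -- The linear term `2u(u' - u)` has nonnegative mean by the sub-mean value property and `u
          -- ≥ 0`, so dropping it leaves the energy.
          have heq : ∀ θ, ζ w * q w - ζ w * q (circleMap w r θ) =
              ζ w * ((u (circleMap w r θ) - u w) ^ 2 + 2 * u w * (u (circleMap w r θ) - u w)) := by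
            intro θ; simp only [hq]; ring
          simp only [heq]
          rw [integral_const_mul, integral_const_mul, integral_add hsq hX]
          exact mul_le_mul_of_nonneg_left (by linarith) (quadCutoff_nonneg _ _ _)
        · have h0 : ζ w = 0 := quadCutoff_eq_zero (by linarith) hw
          rw [hζdef] at h0
          simp [hζdef, h0]
    _ = ∫ p : ℝ × ℂ, (ζ p.2 * q p.2 - ζ (p.2 - circleMap 0 r p.1) * q p.2)
        ∂(angleMeasure.prod volume) := by
        rw [integral_sub hA hC, integral_sub hA hB, hBC]
    _ ≤ ∫ w, 2 * Real.pi * r ^ 2 * (2 * (1 - u w)) := by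
        rw [integral_prod_symm _ hAB]
        refine integral_mono hAB.integral_prod_right
          ((hu.integrable_one_sub.const_mul 2).const_mul _) fun w => ?_
        simp only [← sub_mul]
        rw [integral_mul_const]
        exact mul_le_mul (quadCutoff_sub_mean_le _ _ _ _) (hq1 w) (hq0 w) (by positivity)
    _ = _ := by
        rw [integral_const_mul, integral_const_mul]
        ring

end IsDiskWeight

/-! ### The approximate Cauchy theorem -/

namespace IsDiskWeight

variable {u : ℂ → ℝ} {z₀ : ℂ} {a : ℝ} {F : Type*} [NormedAddCommGroup F] [NormedSpace ℂ F]
  [CompleteSpace F] {f : ℂ → F} {χ : ℂ → ℝ}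

/-- Primes mark values at the shifted point: `c` is the test function, `v` the weight, `y` the
cutoff made from it, and `x` the norm of `f`. Young's inequality with parameter `t r` splits the
product of `x` and the increment of `v`. The factor `1 / r` in front of the squared increment is
affordable because the energy is of order `r²`. -/
theorem pointwise_bound {x c c' y y' v v' X r t A L ζ : ℝ} (hx : 0 ≤ x) (hr : 0 < r) (ht : 0 < t)
    (hA : 0 < A) (hL : 0 ≤ L) (hc' : 0 ≤ c') (hc1 : c' ≤ 1)
    (hy : y = max 0 (2 * v - 1)) (hy' : y' = max 0 (2 * v' - 1))
    (hv : v ≤ 1) (hX : X = |c' * (y - y') + (c' - c) * (1 - y)| * x)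
    (hcc : |c' - c| ≤ L * r) (hζ : 0 ≤ ζ) (hcζ : c' ≠ 0 → A ≤ ζ) :
    X ≤ r * (t * (1 + L) / 2 * x ^ 2 + L / t * (1 - v)) + 2 / (A * t * r) * (ζ * (v' - v) ^ 2) := by
  have hyy : |y - y'| ≤ 2 * |v' - v| := by
    rw [hy, hy', max_comm 0, max_comm 0]
    refine (abs_max_sub_max_le_abs _ _ _).trans ?_
    rw [← abs_sub_comm, ← abs_two, ← abs_mul]
    exact le_of_eq (congrArg _ (by rw [abs_two]; ring))
  have hy0 : 0 ≤ y := hy ▸ le_max_left _ _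
  have hy1 : y ≤ 1 := hy ▸ max_le zero_le_one (by linarith)
  have hyv : 1 - y ≤ 2 * (1 - v) := by linarith [hy ▸ le_max_right 0 (2 * v - 1)]
  have h1 : |c' * (y - y')| * x ≤ r * (t / 2 * x ^ 2) + 2 / (A * t * r) * (ζ * (v' - v) ^ 2) := by
    by_cases h0 : c' = 0
    · rw [h0]; simp only [zero_mul, abs_zero]; positivity
    have hAζ := hcζ h0
    have h2 : |c' * (y - y')| ≤ 2 * |v' - v| := by
      rw [abs_mul, abs_of_nonneg hc']
      exact (mul_le_of_le_one_left (abs_nonneg _) hc1).trans hyy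
    have h3 : 2 / (t * r) * (v' - v) ^ 2 ≤ 2 / (A * t * r) * (ζ * (v' - v) ^ 2) := by
      rw [div_mul_eq_mul_div, div_mul_eq_mul_div, div_le_div_iff₀ (by positivity) (by positivity)]
      have : 0 ≤ (ζ - A) * (2 * (v' - v) ^ 2 * (t * r)) :=
        mul_nonneg (by linarith) (by positivity)
      nlinarith
    have h4 : 2 * |v' - v| * x ≤ r * (t / 2 * x ^ 2) + 2 / (t * r) * (v' - v) ^ 2 := by
      have h5 : r * (t / 2 * x ^ 2) + 2 / (t * r) * (v' - v) ^ 2 - 2 * |v' - v| * x =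
          (t * r * x - 2 * |v' - v|) ^ 2 / (2 * (t * r)) := by
        rw [← sq_abs (v' - v)]
        field_simp
        ring
      have : 0 ≤ (t * r * x - 2 * |v' - v|) ^ 2 / (2 * (t * r)) := by positivity
      linarith
    exact ((mul_le_mul_of_nonneg_right h2 hx).trans h4).trans (by linarith)
  have h2 : |(c' - c) * (1 - y)| * x ≤ r * (t * L / 2 * x ^ 2 + L / t * (1 - v)) := by
    rw [abs_mul, abs_of_nonneg (by linarith : 0 ≤ 1 - y)]
    have h3 : (1 - y) * x ≤ t / 2 * x ^ 2 + 1 / t * (1 - v) := by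
      have h5 : t / 2 * x ^ 2 + 1 / (2 * t) * (1 - y) ^ 2 - (1 - y) * x =
          (t * x - (1 - y)) ^ 2 / (2 * t) := by
        field_simp
        ring
      have h6 : 0 ≤ (t * x - (1 - y)) ^ 2 / (2 * t) := by positivity
      have h7 : 1 / (2 * t) * (1 - y) ^ 2 ≤ 1 / t * (1 - v) := by
        have : (1 - y) ^ 2 ≤ 2 * (1 - v) := by nlinarith
        calc 1 / (2 * t) * (1 - y) ^ 2 ≤ 1 / (2 * t) * (2 * (1 - v)) :=
              mul_le_mul_of_nonneg_left this (by positivity)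
          _ = _ := by field_simp
      linarith
    calc |c' - c| * (1 - y) * x = |c' - c| * ((1 - y) * x) := by ring
      _ ≤ (L * r) * (t / 2 * x ^ 2 + 1 / t * (1 - v)) :=
        mul_le_mul hcc h3 (mul_nonneg (by linarith) hx) (by positivity)
      _ = _ := by ring
  rw [hX]
  calc _ ≤ (|c' * (y - y')| + |(c' - c) * (1 - y)|) * x :=
        mul_le_mul_of_nonneg_right (abs_add_le _ _) hx
    _ ≤ _ := by rw [add_mul]; refine (add_le_add h1 h2).trans (le_of_eq ?_); ring

/-- Both terms carry a factor `r`. The first is small for small `t`; for fixed `t`, the second is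
small when `u` is close to `1` in `L¹`. -/
theorem norm_integral_circle_le (hu : IsDiskWeight u z₀ a) {r t L : ℝ} (hr : 0 < r) (hra : r < a)
    (ht : 0 < t) (hL : 0 ≤ L) (hfm : StronglyMeasurable f) (hf : Integrable f)
    (hf2 : Integrable fun w => ‖f w‖ ^ 2)
    (hχm : Continuous χ) (hχ0 : ∀ w, 0 ≤ χ w) (hχ1 : ∀ w, χ w ≤ 1)
    (hχL : ∀ w w', |χ w - χ w'| ≤ L * ‖w - w'‖)
    (hχs : ∀ w, χ w ≠ 0 → w ∈ Metric.closedBall z₀ (4 * a))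
    (hcauchy : ∀ w, χ w ≠ 0 → 1 / 2 < u w →
      ∫ θ : ℝ, Complex.exp (θ * Complex.I) • f (w - circleMap 0 r θ) ∂angleMeasure = 0) :
    ‖∫ θ : ℝ, Complex.exp (θ * Complex.I) • (∫ w, χ (circleMap w r θ) • f w) ∂angleMeasure‖ ≤
      r * (Real.pi * t * (1 + L) * ∫ w, ‖f w‖ ^ 2) +
      r * ((2 * Real.pi * L + 8 * Real.pi / (11 * a ^ 2)) / t * ∫ w, (1 - u w)) := by
  have ha : 0 < a := hr.trans hra
  have hu' := hu.measurable
  set ν := angleMeasure.prod (volume : Measure ℂ) with hν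
  -- This cutoff vanishes exactly where `u ≤ 1/2`, so `hcauchy` applies wherever `χ η ≠ 0`, and it
  -- is Lipschitz in `u`.
  set η : ℂ → ℝ := fun w => max 0 (2 * u w - 1) with hη
  have hηm : Measurable η := measurable_const.max ((hu'.const_mul 2).sub measurable_const)
  have hη0 : ∀ w, 0 ≤ η w := fun w => le_max_left _ _
  have hη1 : ∀ w, η w ≤ 1 := fun w => max_le zero_le_one (by linarith [hu.le_one w])
  have hcm := measurable_circleMap_prod r
  have hem : Measurable fun p : ℝ × ℂ => Complex.exp (p.1 * Complex.I) := by fun_prop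
  have hfm2 : StronglyMeasurable fun p : ℝ × ℂ => f p.2 := hfm.comp_measurable measurable_snd
  have hfr : Integrable (fun w => ‖f w‖) := hf.norm
  have hen : ∀ θ : ℝ, ‖Complex.exp (θ * Complex.I)‖ = 1 := Complex.norm_exp_ofReal_mul_I
  have hgen : ∀ k : ℝ × ℂ → ℝ, Measurable k → (∀ p, |k p| ≤ 1) →
      Integrable (fun p : ℝ × ℂ => Complex.exp (p.1 * Complex.I) • k p • f p.2) ν := by
    intro k hk hk1
    refine integrable_prod_of_norm_le (hem.stronglyMeasurable.smul
      (hk.stronglyMeasurable.smul hfm2)).aestronglyMeasurable hfr fun θ w => ?_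
    rw [norm_smul, hen, one_mul, norm_smul]
    exact mul_le_of_le_one_left (norm_nonneg _) (hk1 _)
  have hG := hgen (fun p => χ (circleMap p.2 r p.1)) (hχm.measurable.comp hcm)
    fun p => abs_le.2 ⟨by linarith [hχ0 (circleMap p.2 r p.1)], hχ1 _⟩
  have hH1 := hgen (fun p => χ (circleMap p.2 r p.1) * η (circleMap p.2 r p.1))
    ((hχm.measurable.comp hcm).mul (hηm.comp hcm)) fun p => by
      rw [abs_of_nonneg (mul_nonneg (hχ0 _) (hη0 _))]
      exact mul_le_one₀ (hχ1 _) (hη0 _) (hη1 _)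
  have hH0 := hgen (fun p => χ p.2 * (1 - η p.2))
    ((hχm.measurable.comp measurable_snd).mul (measurable_const.sub (hηm.comp measurable_snd)))
    fun p => by
      rw [abs_of_nonneg (mul_nonneg (hχ0 _) (by linarith [hη1 p.2]))]
      exact mul_le_one₀ (hχ1 _) (by linarith [hη1 p.2]) (by linarith [hη0 p.2])
  -- Apart from `e^{iθ}` the integrand is independent of `θ`, so the angular integral is zero.
  -- Subtracting this term turns `χ'(1 - η')` into a difference that is small with `r`.
  have hI0 : ∫ p : ℝ × ℂ, Complex.exp (p.1 * Complex.I) • (χ p.2 * (1 - η p.2)) • f p.2 ∂ν = 0 := by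
    rw [integral_prod_symm _ hH0]
    simp only [integral_smul_const, integral_exp_mul_I_angleMeasure, zero_smul, integral_zero]
  -- After the substitution `w ↦ w - r e^{iθ}` the cutoffs no longer depend on `θ`, and Cauchy's
  -- theorem on the circle around `w` applies wherever they do not vanish.
  have hI1 : ∫ p : ℝ × ℂ, Complex.exp (p.1 * Complex.I) •
      (χ (circleMap p.2 r p.1) * η (circleMap p.2 r p.1)) • f p.2 ∂ν = 0 := by
    have hΨ := measurePreserving_circleMap_prod r
    set k : ℝ × ℂ → F := fun p =>
      Complex.exp (p.1 * Complex.I) • (χ p.2 * η p.2) • f (p.2 - circleMap 0 r p.1) with hk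
    have hkm : StronglyMeasurable k := by
      refine hem.stronglyMeasurable.smul (((hχm.measurable.comp measurable_snd).mul
        (hηm.comp measurable_snd)).stronglyMeasurable.smul (hfm.comp_measurable ?_))
      exact measurable_snd.sub ((continuous_circleMap 0 r).measurable.comp measurable_fst)
    have hcomp : (k ∘ fun p : ℝ × ℂ => (p.1, circleMap p.2 r p.1)) = fun p : ℝ × ℂ =>
        Complex.exp (p.1 * Complex.I) •
          (χ (circleMap p.2 r p.1) * η (circleMap p.2 r p.1)) • f p.2 := by
      ext p
      simp only [hk, Function.comp_apply]
      rw [circleMap_eq_add p.2 r p.1, add_sub_cancel_right]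
    have hki : Integrable k ν := by
      rw [← hΨ.integrable_comp hkm.aestronglyMeasurable, hcomp]
      exact hH1
    have : ∫ p, k p ∂ν = 0 := by
      rw [integral_prod_symm _ hki]
      refine (integral_congr_ae (Eventually.of_forall fun w => ?_)).trans (integral_zero _ _)
      simp only [hk]
      by_cases h : χ w ≠ 0 ∧ 1 / 2 < u w
      · simp_rw [smul_comm _ (χ w * η w)]
        rw [integral_smul, hcauchy w h.1 h.2, smul_zero]
      · have h0 : χ w * η w = 0 := by
          rw [mul_eq_zero]
          by_cases hw : χ w = 0
          · exact Or.inl hw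
          · exact Or.inr (max_eq_left (by linarith [not_lt.1 fun h' => h ⟨hw, h'⟩]))
        simp [h0]
    rw [← hcomp, ← this]
    conv_rhs => rw [hν, ← hΨ.map_eq]
    rw [integral_map hΨ.measurable.aemeasurable (by rw [hΨ.map_eq]; exact hki.aestronglyMeasurable)]
    rfl
  have hE := hu.integrable_energy ha r
  have hB1 : Integrable (fun p : ℝ × ℂ => r * (t * (1 + L) / 2 * ‖f p.2‖ ^ 2 +
      L / t * (1 - u p.2))) ν :=
    (((hf2.const_mul (t * (1 + L) / 2)).add
      (hu.integrable_one_sub.const_mul (L / t))).const_mul r).comp_snd angleMeasure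
  have hB2 : Integrable (fun p : ℝ × ℂ => 2 / (11 * a ^ 2 * t * r) *
      (quadCutoff z₀ (6 * a) p.2 * (u (circleMap p.2 r p.1) - u p.2) ^ 2)) ν := hE.const_mul _
  have hswap : ∫ θ : ℝ, Complex.exp (θ * Complex.I) • (∫ w, χ (circleMap w r θ) • f w) ∂angleMeasure =
      ∫ p : ℝ × ℂ, (Complex.exp (p.1 * Complex.I) • χ (circleMap p.2 r p.1) • f p.2 -
        Complex.exp (p.1 * Complex.I) •
          (χ (circleMap p.2 r p.1) * η (circleMap p.2 r p.1)) • f p.2 -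
        Complex.exp (p.1 * Complex.I) • (χ p.2 * (1 - η p.2)) • f p.2) ∂ν := by
    have hGH : Integrable (fun p : ℝ × ℂ =>
        Complex.exp (p.1 * Complex.I) • χ (circleMap p.2 r p.1) • f p.2 -
        Complex.exp (p.1 * Complex.I) •
          (χ (circleMap p.2 r p.1) * η (circleMap p.2 r p.1)) • f p.2) ν := hG.sub hH1
    rw [integral_sub hGH hH0, hI0, integral_sub hG hH1, hI1, sub_zero, sub_zero,
      integral_prod _ hG]
    simp only [integral_smul]
  rw [hswap]
  refine (norm_integral_le_of_norm_le (hB1.add hB2) (Eventually.of_forall fun p => ?_)).trans ?_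
  · rw [← smul_sub, ← smul_sub, norm_smul, hen, one_mul, ← sub_smul, ← sub_smul, norm_smul,
      Real.norm_eq_abs]
    -- If `χ` is nonzero at the shifted point, that point is within `4a` of `z₀`, so `w` is within
    -- `5a` and the energy cutoff is at least `36a² - 25a² = 11a²`.
    refine pointwise_bound (c := χ p.2) (c' := χ (circleMap p.2 r p.1)) (y := η p.2)
      (y' := η (circleMap p.2 r p.1)) (A := 11 * a ^ 2) (norm_nonneg _) hr ht (by positivity) hL
      (hχ0 _) (hχ1 _) rfl rfl (hu.le_one _) ?_ ?_ (quadCutoff_nonneg _ _ _) fun hne => ?_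
    · congr 2; ring
    · refine (hχL _ _).trans_eq ?_
      rw [circleMap_sub_center, norm_circleMap_zero, abs_of_pos hr]
    · have h1 := hχs _ hne
      rw [Metric.mem_closedBall, dist_eq_norm] at h1
      have h2 : ‖p.2 - z₀‖ ≤ 5 * a := by
        have h3 : p.2 - z₀ = (circleMap p.2 r p.1 - z₀) - (circleMap p.2 r p.1 - p.2) := by ring
        rw [h3]
        refine (norm_sub_le _ _).trans ?_
        rw [circleMap_sub_center, norm_circleMap_zero, abs_of_pos hr]
        linarith
      refine le_trans ?_ (le_max_right _ _)
      nlinarith [norm_nonneg (p.2 - z₀)]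
  · simp only [Pi.add_apply]
    rw [integral_add hB1 hB2, integral_const_mul (2 / (11 * a ^ 2 * t * r)),
      integral_prod_symm _ hB1]
    simp only [integral_const, angleMeasure_real_univ, smul_eq_mul]
    rw [integral_const_mul, integral_const_mul, integral_add (hf2.const_mul _)
      (hu.integrable_one_sub.const_mul _), integral_const_mul, integral_const_mul]
    have hen2 := mul_le_mul_of_nonneg_left (hu.energy_le hr hra)
      (by positivity : 0 ≤ 2 / (11 * a ^ 2 * t * r))
    refine (add_le_add_right hen2 _).trans (le_of_eq ?_)
    field_simp
    ring

end IsDiskWeight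

/-! ### Weights from subharmonic functions -/

/-- The function `exp (k (φ - m))`, extended by `1` outside a disk. -/
noncomputable def expWeight (φ : ℂ → EReal) (m k : ℝ) (z₀ : ℂ) (a : ℝ) (w : ℂ) : ℝ :=
  open Classical in
  if w ∈ Metric.closedBall z₀ (7 * a) then
    if φ w = ⊥ then 0 else Real.exp (k * ((φ w).toReal - m)) else 1

namespace IsSubharmonicOnPlane

variable {φ : ℂ → EReal} {Ω : Set ℂ} {z₀ : ℂ} {a m k : ℝ}

theorem exists_le_coe (hφ : IsSubharmonicOnPlane φ Ω) {S : Set ℂ} (hS : IsCompact S)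
    (hSΩ : S ⊆ Ω) : ∃ m : ℝ, ∀ z ∈ S, φ z ≤ m := by
  rcases S.eq_empty_or_nonempty with rfl | hne
  · exact ⟨0, fun z hz => hz.elim⟩
  · obtain ⟨x, hx, hmax⟩ := (hφ.1.mono hSΩ).exists_isMaxOn hne hS
    refine ⟨(φ x).toReal, fun z hz => (hmax hz).trans ?_⟩
    exact EReal.le_coe_toReal (hφ.2.1 x (hSΩ hx))

theorem toReal_le {w : ℂ} (hm : φ w ≤ m) (hbot : φ w ≠ ⊥) : (φ w).toReal ≤ m := by
  have h := EReal.toReal_le_toReal hm hbot (EReal.coe_ne_top m)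
  rwa [EReal.toReal_coe] at h

/-- The sub-mean value property is Jensen's inequality for `exp`, proved with the tangent line at
the value in the centre. If `φ c = ⊥` the weight at `c` is `0` and nothing is needed. Circles of
radius less than `a` with centre in the `6a`-disk stay in the `7a`-disk, so the value `1` outside
does not interfere. -/
theorem isDiskWeight_expWeight (hφ : IsSubharmonicOnPlane φ Ω) (hk : 0 ≤ k)
    (hΩ : Metric.closedBall z₀ (7 * a) ⊆ Ω) (hm : ∀ z ∈ Metric.closedBall z₀ (7 * a), φ z ≤ m) :
    IsDiskWeight (expWeight φ m k z₀ a) z₀ a := by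
  classical
  have hmeas : Measurable (expWeight φ m k z₀ a) := by
    have h1 := (hφ.1.mono hΩ).measurable_piecewise Metric.isClosed_closedBall.measurableSet 0
    have h2 : Measurable fun x : EReal => if x = ⊥ then 0 else Real.exp (k * (x.toReal - m)) :=
      Measurable.ite (measurableSet_singleton _) measurable_const
        (((measurable_ereal_toReal.sub_const m).const_mul k).exp)
    have h3 : expWeight φ m k z₀ a = (Metric.closedBall z₀ (7 * a)).piecewise
        ((fun x : EReal => if x = ⊥ then 0 else Real.exp (k * (x.toReal - m))) ∘
          (Metric.closedBall z₀ (7 * a)).piecewise φ fun _ => 0) fun _ => 1 := by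
      ext w
      by_cases hw : w ∈ Metric.closedBall z₀ (7 * a)
      · rw [piecewise_eq_of_mem _ _ _ hw, Function.comp_apply, piecewise_eq_of_mem _ _ _ hw,
          expWeight, if_pos hw]
      · rw [piecewise_eq_of_notMem _ _ _ hw, expWeight, if_neg hw]
    rw [h3]
    exact (h2.comp h1).piecewise Metric.isClosed_closedBall.measurableSet measurable_const
  have hnn : ∀ w, 0 ≤ expWeight φ m k z₀ a w := fun w => by
    unfold expWeight; split_ifs <;> positivity
  have hle : ∀ w, expWeight φ m k z₀ a w ≤ 1 := fun w => by
    unfold expWeight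
    split_ifs with h1 h2
    · exact zero_le_one
    · exact Real.exp_le_one_iff.2 (mul_nonpos_of_nonneg_of_nonpos hk
        (by linarith [toReal_le (hm w h1) h2]))
    · exact le_rfl
  refine ⟨hmeas, hnn, hle, fun w hw => by rw [expWeight, if_neg hw], fun c hc r hr hra => ?_⟩
  have hcr : Metric.closedBall c r ⊆ Metric.closedBall z₀ (7 * a) := by
    refine Metric.closedBall_subset_closedBall' ?_
    rw [Metric.mem_closedBall] at hc
    linarith
  have hc7 : c ∈ Metric.closedBall z₀ (7 * a) := hcr (Metric.mem_closedBall_self hr.le)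
  by_cases hbot : φ c = ⊥
  · have : expWeight φ m k z₀ a c = 0 := by rw [expWeight, if_pos hc7, if_pos hbot]
    rw [this, mul_zero]
    exact integral_nonneg fun θ => hnn _
  · obtain ⟨hint, hmean⟩ := hφ.integrable_and_le hr (hcr.trans hΩ) hbot fun z hz => hm z (hcr hz)
    have hae := hφ.ae_circle_ne_bot hr (hcr.trans hΩ) hbot
    have hui : Integrable (fun θ => expWeight φ m k z₀ a (circleMap c r θ)) angleMeasure :=
      (integrable_const (1 : ℝ)).mono'
        (hmeas.comp (continuous_circleMap c r).measurable).aestronglyMeasurable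
        (Eventually.of_forall fun θ => by rw [Real.norm_of_nonneg (hnn _)]; exact hle _)
    set x := (φ c).toReal
    have hval : expWeight φ m k z₀ a c = Real.exp (k * (x - m)) := by
      rw [expWeight, if_pos hc7, if_neg hbot]
    rw [hval]
    have hint' : Integrable (fun θ => (φ (circleMap c r θ)).toReal) angleMeasure := hint
    have hmean' : 2 * Real.pi * x ≤ ∫ θ, (φ (circleMap c r θ)).toReal ∂angleMeasure := hmean
    have hsub : Integrable (fun θ => k * ((φ (circleMap c r θ)).toReal - x)) angleMeasure :=
      (hint'.sub (integrable_const _)).const_mul k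
    have hI : Integrable (fun θ => Real.exp (k * (x - m)) *
        (1 + k * ((φ (circleMap c r θ)).toReal - x))) angleMeasure :=
      ((integrable_const _).add hsub).const_mul _
    refine le_trans ?_ (integral_mono_ae hI hui ?_)
    · rw [integral_const_mul, integral_add (integrable_const _) hsub, integral_const_mul,
        integral_sub hint' (integrable_const _), integral_const, integral_const,
        angleMeasure_real_univ, mul_comm]
      refine mul_le_mul_of_nonneg_left ?_ (Real.exp_pos _).le
      simp only [smul_eq_mul, mul_one]
      exact le_add_of_nonneg_right (mul_nonneg hk (sub_nonneg.2 hmean'))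
    · filter_upwards [hae] with θ hθ
      rw [expWeight, if_pos (hcr (circleMap_mem_closedBall c hr.le θ)), if_neg hθ]
      set y := (φ (circleMap c r θ)).toReal
      have : k * (y - m) = k * (x - m) + k * (y - x) := by ring
      rw [this, Real.exp_add]
      exact mul_le_mul_of_nonneg_left (by linarith [Real.add_one_le_exp (k * (y - x))])
        (Real.exp_pos _).le

/-- Where `φ` is finite, `exp (k (φ - m)) → 1` as `k → 0`; dominated convergence applies since the
integrand is at most the indicator of the disk. -/
theorem tendsto_integral_one_sub_expWeight (hφ : IsSubharmonicOnPlane φ Ω)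
    (hΩ : Metric.closedBall z₀ (7 * a) ⊆ Ω) (hm : ∀ z ∈ Metric.closedBall z₀ (7 * a), φ z ≤ m)
    (hae : ∀ᵐ z, z ∈ Metric.closedBall z₀ (7 * a) → φ z ≠ ⊥) :
    Tendsto (fun n : ℕ => ∫ w, (1 - expWeight φ m (1 / (n + 1)) z₀ a w)) atTop (𝓝 0) := by
  have hw := fun n : ℕ => hφ.isDiskWeight_expWeight (k := 1 / (n + 1)) (by positivity) hΩ hm
  have hb : Integrable ((Metric.closedBall z₀ (7 * a)).indicator fun _ => (1 : ℝ)) :=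
    (integrable_indicator_iff Metric.isClosed_closedBall.measurableSet).2
      (integrableOn_const (isCompact_closedBall _ _).measure_lt_top.ne)
  rw [← integral_zero ℂ ℝ (μ := volume)]
  refine tendsto_integral_of_dominated_convergence _ (fun n =>
    (hw n).integrable_one_sub.aestronglyMeasurable) hb (fun n => Eventually.of_forall fun w => ?_) ?_
  · rw [Real.norm_of_nonneg (by linarith [(hw n).le_one w])]
    by_cases h : w ∈ Metric.closedBall z₀ (7 * a)
    · rw [indicator_of_mem h]; linarith [(hw n).nonneg w]
    · rw [indicator_of_notMem h, (hw n).eq_one w h, sub_self]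
  · filter_upwards [hae] with w hbot
    by_cases h : w ∈ Metric.closedBall z₀ (7 * a)
    · simp only [expWeight, if_pos h, if_neg (hbot h)]
      have h1 : Tendsto (fun n : ℕ => 1 - Real.exp (1 / ((n : ℝ) + 1) * ((φ w).toReal - m))) atTop
          (𝓝 (1 - Real.exp (0 * ((φ w).toReal - m)))) :=
        tendsto_const_nhds.sub ((Real.continuous_exp.tendsto _).comp
          (tendsto_one_div_add_atTop_nhds_zero_nat.mul_const _))
      simpa using h1
    · simp only [expWeight, if_neg h, sub_self]
      exact tendsto_const_nhds

/-- By upper semicontinuity, `φ < m - log 2 / k` on a neighbourhood of `K`, and compactness of `K`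
gives this neighbourhood a uniform width. There the cutoff `max 0 (2u - 1)` vanishes. -/
theorem exists_expWeight_le_near (hφ : IsSubharmonicOnPlane φ Ω) (hk : 0 < k)
    (hΩ : Metric.closedBall z₀ (7 * a) ⊆ Ω) {K : Set ℂ} (hK : IsCompact K)
    (hKb : K ⊆ Metric.ball z₀ (7 * a)) (hKφ : ∀ z ∈ K, φ z = ⊥) :
    ∃ δ > 0, ∀ y ∈ K, ∀ w, dist w y < δ → expWeight φ m k z₀ a w ≤ 1 / 2 := by
  obtain ⟨V, hV, hVe⟩ := upperSemicontinuousOn_iff_preimage_Iio.1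
    (hφ.1.mono (Metric.ball_subset_closedBall.trans hΩ)) ((m - Real.log 2 / k : ℝ) : EReal)
  have hKV : K ⊆ Metric.ball z₀ (7 * a) ∩ V := by
    rw [← hVe]
    refine fun y hy => ⟨hKb hy, ?_⟩
    rw [mem_preimage, hKφ y hy]
    exact EReal.bot_lt_coe _
  obtain ⟨δ, hδ, hδK⟩ := hK.exists_thickening_subset_open (Metric.isOpen_ball.inter hV) hKV
  refine ⟨δ, hδ, fun y hy w hw => ?_⟩
  have hwV := hδK (Metric.mem_thickening_iff.2 ⟨y, hy, hw⟩)
  rw [← hVe] at hwV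
  rw [expWeight, if_pos (Metric.ball_subset_closedBall hwV.1)]
  split_ifs with h
  · norm_num
  · have h1 := toReal_le (show φ w ≤ _ from (le_of_lt hwV.2)) h
    have h2 : k * ((φ w).toReal - m) ≤ -Real.log 2 := by
      have : k * ((φ w).toReal - m) ≤ k * (-(Real.log 2 / k)) :=
        mul_le_mul_of_nonneg_left (by linarith) hk.le
      refine this.trans (le_of_eq ?_)
      field_simp
    refine (Real.exp_le_exp.2 h2).trans (le_of_eq ?_)
    rw [Real.exp_neg, Real.exp_log two_pos, one_div]

end IsSubharmonicOnPlane

/-! ### Cauchy's theorem on circles and its weak form across polar sets -/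

theorem integral_exp_smul_eq_zero {F : Type*} [NormedAddCommGroup F] [NormedSpace ℂ F]
    {f : ℂ → F} {w : ℂ} {r : ℝ} (hr : 0 < r)
    (hf : ∀ z ∈ Metric.closedBall w r, DifferentiableAt ℂ f z) :
    ∫ θ : ℝ, Complex.exp (θ * Complex.I) • f (w - circleMap 0 r θ) ∂angleMeasure = 0 := by
  -- Reflection in `w` turns the points `w - r e^{iθ}` into the standard parametrization of the
  -- circle.
  set g : ℂ → F := fun z => f (2 * w - z) with hg
  have hgd : ∀ z ∈ Metric.closedBall w r, DifferentiableAt ℂ g z := by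
    intro z hz
    have h1 : 2 * w - z ∈ Metric.closedBall w r := by
      rw [Metric.mem_closedBall, dist_eq_norm] at hz ⊢
      rw [show 2 * w - z - w = -(z - w) by ring, norm_neg]
      exact hz
    exact (hf _ h1).comp z ((differentiableAt_const _).sub differentiableAt_id)
  have h := Complex.circleIntegral_eq_zero_of_differentiable_on_off_countable hr.le
    (countable_empty) (fun z hz => (hgd z hz).continuousAt.continuousWithinAt)
    (fun z hz => hgd z (Metric.ball_subset_closedBall hz.1))
  rw [circleIntegral, ← integral_angleMeasure] at h
  have h2 : ∀ θ : ℝ, deriv (circleMap w r) θ • g (circleMap w r θ) =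
      (r * Complex.I : ℂ) • Complex.exp (θ * Complex.I) • f (w - circleMap 0 r θ) := by
    intro θ
    rw [deriv_circleMap, hg, smul_smul]
    congr 1
    · simp only [circleMap]; ring
    · simp only [circleMap]; ring_nf
  simp only [h2] at h
  rw [integral_smul] at h
  exact (smul_eq_zero.1 h).resolve_left (mul_ne_zero (by exact_mod_cast hr.ne') Complex.I_ne_zero)

/-- A square-integrable function which is holomorphic outside a polar set satisfies the
infinitesimal Cauchy theorem against Lipschitz test functions. -/
theorem IsSubharmonicOnPlane.norm_integral_circle_le {φ : ℂ → EReal} {Ω : Set ℂ} {z₀ : ℂ} {a L : ℝ}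
    (hφ : IsSubharmonicOnPlane φ Ω)
    (ha : 0 < a) (hΩ : Metric.closedBall z₀ (7 * a) ⊆ Ω)
    (hae : ∀ᵐ z, z ∈ Metric.closedBall z₀ (7 * a) → φ z ≠ ⊥) {K : Set ℂ}
    (hK : IsCompact (K ∩ Metric.closedBall z₀ (6 * a)))
    (hKφ : ∀ z ∈ K ∩ Metric.closedBall z₀ (6 * a), φ z = ⊥)
    {F : Type*} [NormedAddCommGroup F] [NormedSpace ℂ F] [CompleteSpace F] {f : ℂ → F}
    (hfm : StronglyMeasurable f) (hf : Integrable f) (hf2 : Integrable fun w => ‖f w‖ ^ 2)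
    (hfd : ∀ z ∈ Metric.ball z₀ (6 * a) \ K, DifferentiableAt ℂ f z)
    {χ : ℂ → ℝ} (hL : 0 ≤ L)
    (hχm : Continuous χ) (hχ0 : ∀ w, 0 ≤ χ w) (hχ1 : ∀ w, χ w ≤ 1)
    (hχL : ∀ w w', |χ w - χ w'| ≤ L * ‖w - w'‖)
    (hχs : ∀ w, χ w ≠ 0 → w ∈ Metric.closedBall z₀ (4 * a)) {ε : ℝ} (hε : 0 < ε) :
    ∃ r₀ > 0, ∀ r, 0 < r → r < r₀ →
      ‖∫ θ : ℝ, Complex.exp (θ * Complex.I) •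
        (∫ w, χ (circleMap w r θ) • f w) ∂angleMeasure‖ ≤ r * ε := by
  obtain ⟨m, hm⟩ := hφ.exists_le_coe (isCompact_closedBall z₀ (7 * a)) hΩ
  set N := ∫ w, ‖f w‖ ^ 2
  have hN : 0 ≤ N := integral_nonneg fun w => sq_nonneg _
  -- Order of choices: `t` makes the `L²` term at most `ε / 2`, then a small exponent `k = 1 / (n +
  -- 1)` makes the weight term less than `ε / 2`, and only then is the range of `r` fixed by the
  -- width `δ`. The `+ 1` keeps the denominator positive when `f` vanishes.
  set t := ε / (2 * (Real.pi * (1 + L) * N + 1)) with ht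
  have hden : 0 < Real.pi * (1 + L) * N + 1 := by positivity
  have ht0 : 0 < t := by positivity
  have ht1 : Real.pi * t * (1 + L) * N ≤ ε / 2 := by
    have : t * (Real.pi * (1 + L) * N + 1) = ε / 2 := by rw [ht]; field_simp
    nlinarith
  set A := (2 * Real.pi * L + 8 * Real.pi / (11 * a ^ 2)) / t
  have hlim := (hφ.tendsto_integral_one_sub_expWeight hΩ hm hae).const_mul A
  rw [mul_zero] at hlim
  obtain ⟨n, hn⟩ := (hlim.eventually (gt_mem_nhds (half_pos hε))).exists
  have hkpos : (0 : ℝ) < 1 / ((n : ℝ) + 1) := by positivity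
  have hw := hφ.isDiskWeight_expWeight hkpos.le hΩ hm
  obtain ⟨δ, hδ, hδK⟩ := hφ.exists_expWeight_le_near (m := m) hkpos hΩ hK
    (fun y hy => Metric.closedBall_subset_ball (by linarith) hy.2) hKφ
  refine ⟨min δ a, lt_min hδ ha, fun r hr hr' => ?_⟩
  have hrδ := hr'.trans_le (min_le_left _ _)
  have hra := hr'.trans_le (min_le_right _ _)
  refine (hw.norm_integral_circle_le hr hra ht0 hL hfm hf hf2 hχm hχ0 hχ1 hχL hχs ?_).trans ?_
  · intro w hw0 hwu
    have hw4 := hχs w hw0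
    rw [Metric.mem_closedBall] at hw4
    refine integral_exp_smul_eq_zero hr fun z hz => hfd z ?_
    rw [Metric.mem_closedBall] at hz
    have hzb : dist z z₀ < 6 * a := (dist_triangle z w z₀).trans_lt (by linarith)
    refine ⟨hzb, fun hzK => ?_⟩
    have := hδK z ⟨hzK, hzb.le⟩ w (by rw [dist_comm]; linarith)
    linarith
  · rw [← mul_add]
    exact mul_le_mul_of_nonneg_left (by linarith) hr.le

/-! ### Mollification by a radial bump function -/

/-- A smooth radial function supported in the closed disk of radius `ε`. -/
noncomputable def radialBump (ε : ℝ) (w : ℂ) : ℝ := Real.smoothTransition (1 - ‖w‖ ^ 2 / ε ^ 2)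

theorem contDiff_radialBump (ε : ℝ) : ContDiff ℝ ∞ (radialBump ε) :=
  Real.smoothTransition.contDiff.comp
    (contDiff_const.sub ((contDiff_norm_sq ℝ).div_const _))

theorem radialBump_nonneg (ε : ℝ) (w : ℂ) : 0 ≤ radialBump ε w := Real.smoothTransition.nonneg _

theorem radialBump_le_one (ε : ℝ) (w : ℂ) : radialBump ε w ≤ 1 := Real.smoothTransition.le_one _

theorem norm_le_of_radialBump_ne_zero {ε : ℝ} (hε : 0 < ε) {w : ℂ} (h : radialBump ε w ≠ 0) :
    ‖w‖ ≤ ε := by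
  contrapose! h
  refine Real.smoothTransition.zero_of_nonpos (sub_nonpos.2 ?_)
  rw [one_le_div (by positivity)]
  exact pow_le_pow_left₀ hε.le h.le 2

theorem hasCompactSupport_radialBump {ε : ℝ} (hε : 0 < ε) : HasCompactSupport (radialBump ε) :=
  HasCompactSupport.intro (isCompact_closedBall 0 ε) fun w hw => by
    by_contra h
    exact hw (by simpa using norm_le_of_radialBump_ne_zero hε h)

theorem integral_radialBump_pos {ε : ℝ} (hε : 0 < ε) : 0 < ∫ w, radialBump ε w := by
  refine (contDiff_radialBump ε).continuous.integral_pos_of_hasCompactSupport_nonneg_nonzero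
    (hasCompactSupport_radialBump hε) (radialBump_nonneg ε) (x := 0) ?_
  simp [radialBump]

theorem integral_eq_polar {G : Type*} [NormedAddCommGroup G] [NormedSpace ℝ G] {k : ℂ → G} {z : ℂ}
    {R : ℝ} (hk : Continuous k) (hs : ∀ w, k w ≠ 0 → ‖w - z‖ ≤ R) :
    ∫ w, k w = ∫ r in Ioi (0 : ℝ), ∫ θ in Ioo (-Real.pi) Real.pi, r • k (circleMap z r θ) := by
  have hsymm : ∀ q : ℝ × ℝ, z + Complex.polarCoord.symm q = circleMap z q.1 q.2 := by
    intro q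
    rw [circleMap, Complex.polarCoord_symm_apply, Complex.exp_mul_I, Complex.ofReal_cos,
      Complex.ofReal_sin]
  rw [← integral_add_left_eq_self k z, ← Complex.integral_comp_polarCoord_symm]
  simp only [hsymm]
  rw [polarCoord_target, Measure.volume_eq_prod, setIntegral_prod]
  have hc : Continuous fun q : ℝ × ℝ => q.1 • k (circleMap z q.1 q.2) := by
    refine continuous_fst.smul (hk.comp ?_)
    unfold circleMap
    fun_prop
  have h1 : IntegrableOn (fun q : ℝ × ℝ => q.1 • k (circleMap z q.1 q.2))
      (Icc 0 R ×ˢ Icc (-Real.pi) Real.pi) (volume.prod volume) :=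
    hc.continuousOn.integrableOn_compact (isCompact_Icc.prod isCompact_Icc)
  refine h1.of_forall_sdiff_eq_zero (measurableSet_Ioi.prod measurableSet_Ioo) fun q hq => ?_
  by_contra hne
  refine hq.2 ⟨⟨(mem_Ioi.1 hq.1.1).le, ?_⟩, Ioo_subset_Icc_self hq.1.2⟩
  have h2 := hs _ (right_ne_zero_of_smul hne)
  rw [circleMap_sub_center, norm_circleMap_zero] at h2
  exact (le_abs_self _).trans h2

theorem contDiff_integral_radialBump_smul {F : Type*} [NormedAddCommGroup F]
    [NormedSpace ℂ F] {f : ℂ → F} (hf : Integrable f) {ε : ℝ} (hε : 0 < ε) :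
    ContDiff ℝ ∞ fun z => ∫ w, radialBump ε (z - w) • f w := by
  have h := (hasCompactSupport_radialBump hε).contDiff_convolution_right (μ := volume) (f := f)
    (ContinuousLinearMap.lsmul ℝ ℝ).flip hf.locallyIntegrable (contDiff_radialBump ε)
  exact h

/-! ### Mean values, a Morera-type criterion and local extension -/

section

variable {F : Type*} [NormedAddCommGroup F] [NormedSpace ℂ F] [CompleteSpace F]

theorem integral_Ioo_circleMap_eq {f : ℂ → F} {z : ℂ} {r : ℝ}
    (hf : ∀ w ∈ Metric.closedBall z |r|, DifferentiableAt ℂ f w) :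
    ∫ θ in Ioo (-Real.pi) Real.pi, f (circleMap z r θ) = (2 * Real.pi) • f z := by
  rw [← circleAverage_of_differentiable_on_off_countable countable_empty
    (fun w hw => (hf w hw).continuousAt.continuousWithinAt)
    (fun w hw => hf w (Metric.ball_subset_closedBall hw.1)), Real.circleAverage_def, smul_smul,
    mul_inv_cancel₀ Real.two_pi_pos.ne', one_smul, ← integral_Ioc_eq_integral_Ioo,
    ← intervalIntegral.integral_of_le (by linarith [Real.pi_pos])]
  have hper : Function.Periodic (fun θ => f (circleMap z r θ)) (2 * Real.pi) := fun θ => by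
    simp only [periodic_circleMap z r θ]
  have := hper.intervalIntegral_add_eq (-Real.pi) 0
  rwa [zero_add, show -Real.pi + 2 * Real.pi = Real.pi by ring] at this

/-- The mean value property of holomorphic functions for radial averages. -/
theorem integral_radialBump_smul {f : ℂ → F} {z : ℂ} {ε : ℝ} (hε : 0 < ε)
    (hf : ∀ w ∈ Metric.closedBall z ε, DifferentiableAt ℂ f w) :
    ∫ w, radialBump ε (z - w) • f w = (∫ w, radialBump ε w) • f z := by
  have hρ : Continuous fun w => radialBump ε (z - w) :=
    (contDiff_radialBump ε).continuous.comp (continuous_const.sub continuous_id)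
  have hs : ∀ {w : ℂ}, radialBump ε (z - w) ≠ 0 → ‖w - z‖ ≤ ε := fun h => by
    rw [norm_sub_rev]; exact norm_le_of_radialBump_ne_zero hε h
  have hc' : Continuous fun w => radialBump ε (z - w) • f z := hρ.smul continuous_const
  have hc : Continuous fun w => radialBump ε (z - w) • f w := by
    refine continuous_iff_continuousAt.2 fun w => ?_
    by_cases hw : w ∈ Metric.closedBall z ε
    · exact hρ.continuousAt.smul (hf w hw).continuousAt
    · refine (continuousAt_const (y := (0 : F))).congr ?_
      filter_upwards [Metric.isClosed_closedBall.isOpen_compl.mem_nhds hw] with y hy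
      have : radialBump ε (z - y) = 0 := by
        by_contra h
        exact hy (mem_closedBall_iff_norm.2 (hs h))
      rw [this, zero_smul]
  rw [← integral_sub_left_eq_self (radialBump ε) volume z, ← integral_smul_const,
    integral_eq_polar hc (R := ε) fun w hw => hs (left_ne_zero_of_smul hw),
    integral_eq_polar hc' (z := z) (R := ε)
      fun w hw => hs (left_ne_zero_of_smul hw)]
  refine setIntegral_congr_fun measurableSet_Ioi fun r hr => ?_
  have hr0 : 0 < r := hr
  have hrad : ∀ θ, radialBump ε (z - circleMap z r θ) = radialBump ε r := fun θ => by
    have h1 : ‖z - circleMap z r θ‖ = ‖(r : ℂ)‖ := by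
      rw [norm_sub_rev, circleMap_sub_center, norm_circleMap_zero, Complex.norm_real,
        Real.norm_eq_abs]
    rw [radialBump, h1, radialBump]
  simp only [hrad]
  by_cases hne : radialBump ε (r : ℂ) = 0
  · simp [hne]
  · have hrε : |r| ≤ ε := by simpa using norm_le_of_radialBump_ne_zero hε hne
    rw [integral_smul, integral_smul, integral_smul, integral_smul,
      integral_Ioo_circleMap_eq fun w hw => hf w (Metric.closedBall_subset_closedBall hrε hw),
      integral_Ioo_circleMap_eq (f := fun _ => f z) (z := z) (r := r)
        fun w _ => differentiableAt_const _]

/-- A real differentiable function is complex differentiable at a point if its weighted circle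
means there vanish to second order. -/
theorem differentiableAt_of_circle_integral {g : ℂ → F} {z : ℂ} (hg : DifferentiableAt ℝ g z)
    (h : ∀ ε > 0, ∃ r₀ > 0, ∀ r, 0 < r → r < r₀ →
      ‖∫ θ : ℝ, Complex.exp (θ * Complex.I) • g (z - circleMap 0 r θ) ∂angleMeasure‖ ≤ r * ε)
    (hgc : Continuous g) :
    DifferentiableAt ℂ g z := by
  refine differentiableAt_complex_iff_differentiableAt_real.2 ⟨hg, ?_⟩
  set T := fderiv ℝ g z with hT
  have hint : ∀ {k : ℝ → F}, Continuous k → Integrable k angleMeasure := fun hk =>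
    (hk.integrableOn_Icc).mono_set Ioc_subset_Icc_self
  suffices hB : T 1 + Complex.I • T Complex.I = 0 by
    have : Complex.I • (T 1 + Complex.I • T Complex.I) = 0 := by rw [hB, smul_zero]
    rw [smul_add, smul_smul, Complex.I_mul_I, neg_one_smul, ← sub_eq_add_neg, sub_eq_zero] at this
    exact this.symm
  -- Splitting of `T` into complex linear and antilinear parts. After multiplication by `e^{iθ}` the
  -- linear part has frequency two and mean zero, so the circle integral detects only the antilinear
  -- part, which is `∂̄g` up to a factor.
  have hlin : ∀ r θ : ℝ, Complex.exp (θ * Complex.I) • T (circleMap 0 r θ) =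
      (r / 2 : ℂ) • Complex.exp (2 * Complex.I * θ) • (T 1 - Complex.I • T Complex.I) +
      (r / 2 : ℂ) • (T 1 + Complex.I • T Complex.I) := by
    intro r θ
    have h1 : circleMap 0 r θ = (r * Real.cos θ) • (1 : ℂ) + (r * Real.sin θ) • Complex.I := by
      simp only [circleMap, Complex.exp_mul_I, zero_add, Complex.real_smul]
      push_cast
      ring
    rw [h1, map_add, map_smul, map_smul, ← Complex.coe_smul, ← Complex.coe_smul]
    simp only [smul_add, smul_sub, smul_smul]
    have h2 : Complex.exp (2 * Complex.I * θ) = Complex.exp (θ * Complex.I) ^ 2 := by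
      rw [← Complex.exp_nat_mul]; congr 1; push_cast; ring
    have hcs := Complex.cos_sq_add_sin_sq (θ : ℂ)
    rw [h2, Complex.exp_mul_I]
    push_cast
    set C := Complex.cos (θ : ℂ)
    set S := Complex.sin (θ : ℂ)
    have hI := Complex.I_sq
    have e1 : (C + S * Complex.I) * (r * C) =
        (r / 2 * (C + S * Complex.I) ^ 2) + r / 2 := by
      linear_combination (-(r : ℂ) / 2 * S ^ 2) * hI + ((r : ℂ) / 2) * hcs
    have e2 : (C + S * Complex.I) * (r * S) =
        -(r / 2 * ((C + S * Complex.I) ^ 2 * Complex.I)) + r / 2 * Complex.I := by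
      linear_combination ((r : ℂ) * C * S + r / 2 * S ^ 2 * Complex.I) * hI +
        (r / 2 * Complex.I) * hcs
    rw [e1, e2]
    module
  set B := T 1 + Complex.I • T Complex.I with hBdef
  have hexp2 : ∫ θ : ℝ, Complex.exp (2 * Complex.I * θ) ∂angleMeasure = 0 := by
    rw [integral_angleMeasure, integral_exp_mul_complex (by simp)]
    have : (2 * Complex.I * (2 * Real.pi : ℝ) : ℂ) = (2 : ℕ) * (2 * Real.pi * Complex.I) := by
      push_cast; ring
    rw [this, Complex.exp_nat_mul, Complex.exp_two_pi_mul_I]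
    simp
  have hTint : ∀ r : ℝ, ∫ θ : ℝ, Complex.exp (θ * Complex.I) • T (circleMap 0 r θ) ∂angleMeasure =
      (Real.pi * r) • B := by
    intro r
    simp only [hlin]
    rw [integral_add (hint (by fun_prop)) (integrable_const _), integral_smul,
      integral_smul_const, hexp2, zero_smul, smul_zero, zero_add, integral_const,
      angleMeasure_real_univ, ← Complex.coe_smul, ← Complex.coe_smul, smul_smul]
    congr 1
    push_cast
    ring
  have hbound : ∀ ε > 0, ‖B‖ ≤ 3 * ε := by
    intro ε hε
    obtain ⟨r₀, hr₀, hr⟩ := h ε hε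
    have hT' := hasFDerivAt_iff_isLittleO_nhds_zero.1 hg.hasFDerivAt
    obtain ⟨r₁, hr₁, hr'⟩ := Metric.eventually_nhds_iff.1 (hT'.bound hε)
    set r := min r₀ r₁ / 2 with hrdef
    have hrpos : 0 < r := half_pos (lt_min hr₀ hr₁)
    have hrlt : r < min r₀ r₁ := half_lt_self (lt_min hr₀ hr₁)
    have h1 := hr r hrpos (hrlt.trans_le (min_le_left _ _))
    have hcm : Continuous fun θ => circleMap 0 r θ := continuous_circleMap 0 r
    have hi1 : Integrable (fun θ : ℝ => Complex.exp (θ * Complex.I) •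
        (g (z - circleMap 0 r θ) - g z + T (circleMap 0 r θ))) angleMeasure :=
      hint (by fun_prop)
    have hi2 : Integrable (fun θ : ℝ => Complex.exp (θ * Complex.I) •
        g (z - circleMap 0 r θ)) angleMeasure := hint (by fun_prop)
    have hi3 : Integrable (fun θ : ℝ => Complex.exp (θ * Complex.I) • g z) angleMeasure :=
      hint (by fun_prop)
    have hi4 : Integrable (fun θ : ℝ => Complex.exp (θ * Complex.I) • T (circleMap 0 r θ))
      angleMeasure := hint (by fun_prop)
    have heq : (Real.pi * r) • B = (∫ θ : ℝ, Complex.exp (θ * Complex.I) •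
        (g (z - circleMap 0 r θ) - g z + T (circleMap 0 r θ)) ∂angleMeasure) -
        ∫ θ : ℝ, Complex.exp (θ * Complex.I) • g (z - circleMap 0 r θ) ∂angleMeasure := by
      rw [← integral_sub hi1 hi2, ← hTint r]
      have : ∀ θ : ℝ, Complex.exp (θ * Complex.I) •
          (g (z - circleMap 0 r θ) - g z + T (circleMap 0 r θ)) -
          Complex.exp (θ * Complex.I) • g (z - circleMap 0 r θ) =
          Complex.exp (θ * Complex.I) • T (circleMap 0 r θ) -
          Complex.exp (θ * Complex.I) • g z := fun θ => by
        rw [← smul_sub, ← smul_sub]; congr 1; abel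
      simp only [this]
      rw [integral_sub hi4 hi3, integral_smul_const, integral_exp_mul_I_angleMeasure, zero_smul,
        sub_zero]
    have h2 : ‖∫ θ : ℝ, Complex.exp (θ * Complex.I) •
        (g (z - circleMap 0 r θ) - g z + T (circleMap 0 r θ)) ∂angleMeasure‖ ≤
        2 * Real.pi * (ε * r) := by
      refine (norm_integral_le_of_norm_le_const (C := ε * r) (Eventually.of_forall fun θ => ?_)).trans_eq ?_
      · rw [norm_smul, Complex.norm_exp_ofReal_mul_I, one_mul]
        have hn : ‖circleMap 0 r θ‖ = r := by rw [norm_circleMap_zero, abs_of_pos hrpos]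
        have h3 := hr' (y := -circleMap 0 r θ) (by
          rw [dist_zero_right, norm_neg, hn]; exact hrlt.trans_le (min_le_right _ _))
        rwa [map_neg, sub_neg_eq_add, ← sub_eq_add_neg, norm_neg, hn] at h3
      · rw [angleMeasure_real_univ, mul_comm]
    have h4 : Real.pi * r * ‖B‖ ≤ 2 * Real.pi * (ε * r) + r * ε := by
      rw [← Real.norm_of_nonneg (by positivity : 0 ≤ Real.pi * r), ← norm_smul, heq]
      exact (norm_sub_le _ _).trans (add_le_add h2 h1)
    have h5 : 2 * Real.pi * (ε * r) + r * ε ≤ Real.pi * r * (3 * ε) := by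
      nlinarith [Real.pi_gt_three, mul_pos hrpos hε]
    exact le_of_mul_le_mul_left (h4.trans h5) (by positivity)
  have : ‖B‖ ≤ 0 := le_of_forall_pos_le_add fun ε hε => by
    have := hbound (ε / 3) (by positivity)
    linarith
  exact norm_le_zero_iff.1 this

/-- Square-integrable holomorphic functions extend across closed polar sets: local form. -/
theorem IsSubharmonicOnPlane.exists_holomorphic_extension {φ : ℂ → EReal} {Ω : Set ℂ} {z₀ : ℂ}
    {a : ℝ} (hφ : IsSubharmonicOnPlane φ Ω) (ha : 0 < a)
    (hΩ : Metric.closedBall z₀ (7 * a) ⊆ Ω)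
    (hae : ∀ᵐ z, z ∈ Metric.closedBall z₀ (7 * a) → φ z ≠ ⊥) {K : Set ℂ}
    (hK : IsCompact (K ∩ Metric.closedBall z₀ (6 * a)))
    (hKφ : ∀ z ∈ K ∩ Metric.closedBall z₀ (6 * a), φ z = ⊥) {f : ℂ → F}
    (hfm : StronglyMeasurable f) (hf : Integrable f) (hf2 : Integrable fun w => ‖f w‖ ^ 2)
    (hfd : ∀ z ∈ Metric.ball z₀ (6 * a) \ K, DifferentiableAt ℂ f z) :
    ∃ g : ℂ → F, DifferentiableOn ℂ g (Metric.ball z₀ (2 * a)) ∧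
      EqOn g f (Metric.ball z₀ (2 * a) \ K) := by
  -- Normalized radial mollifications of `f`. For `ε ≤ a` and `z` in the `2a`-disk the kernel is
  -- supported within `3a` of `z₀`, hence in the `4a`-disk allowed for test functions.
  set G : ℝ → ℂ → F := fun ε z =>
    (∫ w, radialBump ε w)⁻¹ • ∫ w, radialBump ε (z - w) • f w with hG
  have hGd : ∀ ε, 0 < ε → ε ≤ a → DifferentiableOn ℂ (G ε) (Metric.ball z₀ (2 * a)) := by
    intro ε hε hεa z hz
    have hcd := contDiff_integral_radialBump_smul hf hε
    obtain ⟨L, hL⟩ := (contDiff_radialBump ε).lipschitzWith_of_hasCompactSupport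
      (hasCompactSupport_radialBump hε) (by simp)
    refine (DifferentiableAt.const_smul (differentiableAt_of_circle_integral
      (hcd.differentiable (by simp) z) (fun δ hδ => ?_) hcd.continuous) _).differentiableWithinAt
    obtain ⟨r₀, hr₀, hr⟩ := hφ.norm_integral_circle_le ha hΩ hae hK hKφ hfm hf hf2 hfd
      (χ := fun w => radialBump ε (z - w)) L.coe_nonneg
      ((contDiff_radialBump ε).continuous.comp (continuous_const.sub continuous_id))
      (fun w => radialBump_nonneg _ _) (fun w => radialBump_le_one _ _) (fun w w' => by
        have := hL.dist_le_mul (z - w) (z - w')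
        rwa [dist_eq_norm, dist_eq_norm, Real.norm_eq_abs, sub_sub_sub_cancel_left,
          norm_sub_rev] at this)
      (fun w hw => by
        have h1 := norm_le_of_radialBump_ne_zero hε hw
        rw [← dist_eq_norm, dist_comm] at h1
        have h2 : dist z z₀ < 2 * a := hz
        exact (dist_triangle w z z₀).trans (by linarith)) hδ
    refine ⟨r₀, hr₀, fun r h0 h1 => ?_⟩
    have h2 := hr r h0 h1
    have h3 : ∀ (θ : ℝ) (w : ℂ), z - circleMap w r θ = z - circleMap 0 r θ - w := fun θ w => by
      rw [circleMap_eq_add w]; ring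
    have h4 : ∀ θ : ℝ, ∫ w, radialBump ε (z - circleMap w r θ) • f w =
        ∫ w, radialBump ε (z - circleMap 0 r θ - w) • f w := fun θ =>
      integral_congr_ae (Eventually.of_forall fun w => by simp only [h3 θ w])
    simp only [h4] at h2
    exact h2
  set O := Metric.ball z₀ (2 * a) \ K with hO
  have hOK : O = Metric.ball z₀ (2 * a) \ (K ∩ Metric.closedBall z₀ (6 * a)) := by
    ext w
    simp only [hO, Set.mem_sdiff, mem_inter_iff, not_and]
    refine and_congr_right fun hw => ⟨fun h h' => (h h').elim, fun h h' => h h' ?_⟩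
    exact Metric.ball_subset_closedBall (Metric.ball_subset_ball (by linarith) hw)
  have hOo : IsOpen O := by
    rw [hOK]
    exact Metric.isOpen_ball.sdiff hK.isClosed
  have hOd : ∀ w ∈ O, DifferentiableAt ℂ f w := fun w hw =>
    hfd w ⟨Metric.ball_subset_ball (by linarith) hw.1, hw.2⟩
  -- Otherwise `φ = ⊥` on a whole disk, against finiteness almost everywhere.
  have hOne : O.Nonempty := by
    by_contra hemp
    rw [not_nonempty_iff_eq_empty, hOK, ← Set.bot_eq_empty, sdiff_eq_bot_iff] at hemp
    have h0 : ∀ᵐ z, z ∉ Metric.ball z₀ (2 * a) := by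
      filter_upwards [hae] with z hz hzb
      exact hz (Metric.ball_subset_closedBall (Metric.ball_subset_ball (by linarith) hzb))
        (hKφ z (hemp hzb))
    have h1 : volume (Metric.ball z₀ (2 * a)) = 0 :=
      measure_eq_zero_iff_ae_notMem.2 h0
    exact (Metric.measure_ball_pos volume z₀ (by linarith : 0 < 2 * a)).ne' h1
  have hGf : ∀ ε, 0 < ε → ∀ z, Metric.closedBall z ε ⊆ O → G ε z = f z := by
    intro ε hε z hz
    simp only [hG]
    rw [integral_radialBump_smul hε fun w hw => hOd w (hz hw), smul_smul,
      inv_mul_cancel₀ (integral_radialBump_pos hε).ne', one_smul]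
  obtain ⟨z₁, hz₁⟩ := hOne
  obtain ⟨ρ, hρ, hρO⟩ := Metric.isOpen_iff.1 hOo z₁ hz₁
  set ε₁ := min a (ρ / 3)
  have hε₁ : 0 < ε₁ := lt_min ha (by positivity)
  have hnear : ∀ ε, 0 < ε → ε ≤ ε₁ → ∀ z ∈ Metric.ball z₁ ε₁, G ε z = f z := by
    intro ε hε hle z hz
    refine hGf ε hε z fun w hw => hρO ?_
    rw [Metric.mem_closedBall] at hw
    rw [Metric.mem_ball] at hz ⊢
    have := min_le_right a (ρ / 3)
    exact (dist_triangle w z z₁).trans_lt (by linarith)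
  refine ⟨G ε₁, hGd _ hε₁ (min_le_left _ _), fun z hz => ?_⟩
  obtain ⟨ρ', hρ', hρO'⟩ := Metric.isOpen_iff.1 hOo z hz
  set ε₂ := min ε₁ (ρ' / 2)
  have hε₂ : 0 < ε₂ := lt_min hε₁ (by positivity)
  have hle : ε₂ ≤ ε₁ := min_le_left _ _
  have hlt : ε₂ < ρ' := (min_le_right _ _).trans_lt (by linarith)
  rw [← hGf ε₂ hε₂ z ((Metric.closedBall_subset_ball hlt).trans hρO')]
  -- Both mollifications equal `f` near `z₁`, so they agree on the whole disk; the smaller radius is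
  -- chosen so that the second one equals `f` at `z`.
  refine AnalyticOnNhd.eqOn_of_preconnected_of_eventuallyEq
    ((hGd _ hε₁ (min_le_left _ _)).analyticOnNhd Metric.isOpen_ball)
    ((hGd _ hε₂ (hle.trans (min_le_left _ _))).analyticOnNhd Metric.isOpen_ball)
    (convex_ball z₀ (2 * a)).isPreconnected hz₁.1 ?_ hz.1
  filter_upwards [Metric.ball_mem_nhds z₁ hε₁] with w hw
  rw [hnear ε₁ hε₁ le_rfl w hw, hnear ε₂ hε₂ hle w hw]

end

/-! ### Polar sets on Riemann surfaces -/

section RiemannSurface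

variable {M : Type*} [TopologicalSpace M]

theorem exists_chart_ball {e : OpenPartialHomeomorph M ℂ} {x : M} (hx : x ∈ e.source) {U : Set M}
    (hU : U ∈ 𝓝 x) : ∃ r > 0, Metric.closedBall (e x) r ⊆ e.target ∩ e.symm ⁻¹' U := by
  have h : e.target ∩ e.symm ⁻¹' U ∈ 𝓝 (e x) := by
    refine inter_mem (e.open_target.mem_nhds (e.map_source hx)) ?_
    refine (e.continuousAt_symm (e.map_source hx)).preimage_mem_nhds ?_
    rwa [e.left_inv hx]
  exact Metric.nhds_basis_closedBall.mem_iff.1 h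

/-- A property that holds almost everywhere near a point in a chart holds at points arbitrarily
close to it. -/
theorem exists_mem_of_ae_chart {e : OpenPartialHomeomorph M ℂ} {x : M} (hx : x ∈ e.source)
    {B : Set ℂ} (hB : B ∈ 𝓝 (e x)) {p : M → Prop} (h : ∀ᵐ z, z ∈ B → p (e.symm z)) {O : Set M}
    (hO : O ∈ 𝓝 x) : ∃ y ∈ O, p y := by
  obtain ⟨r, hr, hrO⟩ := exists_chart_ball hx hO
  have hmem : B ∩ Metric.closedBall (e x) r ∈ 𝓝 (e x) :=
    inter_mem hB (Metric.closedBall_mem_nhds _ hr)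
  by_contra! hno
  have h0 : ∀ᵐ z, z ∉ B ∩ Metric.closedBall (e x) r := by
    filter_upwards [h] with z hz hzB
    exact hno _ (hrO hzB.2).2 (hz hzB.1)
  exact (Measure.measure_pos_of_mem_nhds volume hmem).ne' (measure_eq_zero_iff_ae_notMem.2 h0)

variable [ChartedSpace ℂ M] [IsManifold 𝓘(ℂ, ℂ) ω M]

/-- A point `c` close to `x` with `φ c ≠ ⊥` makes `φ` finite almost everywhere in a chart disk
around `c` that contains a neighbourhood of `x`. So the closure of the finiteness set is relatively
open in `U`, as the connectedness argument requires. -/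
theorem IsSubharmonicOn.closure_mem_nhds {φ : M → EReal} {U : Set M} (hφ : IsSubharmonicOn φ U)
    (hU : IsOpen U) {x : M} (hxU : x ∈ U) (hx : x ∈ closure {y ∈ U | φ y ≠ ⊥}) :
    closure {y ∈ U | φ y ≠ ⊥} ∈ 𝓝 x := by
  set e := chartAt ℂ x
  have hxe : x ∈ e.source := mem_chart_source ℂ x
  obtain ⟨R, hR, hRU⟩ := exists_chart_ball hxe (hU.mem_nhds hxU)
  set r := R / 3 with hr
  have hr0 : 0 < r := by positivity
  have hW : e.source ∩ e ⁻¹' Metric.ball (e x) r ∈ 𝓝 x :=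
    inter_mem (e.open_source.mem_nhds hxe)
      ((e.continuousAt hxe).preimage_mem_nhds (Metric.ball_mem_nhds _ hr0))
  obtain ⟨c, ⟨hce, hcb⟩, hcU, hcbot⟩ := mem_closure_iff_nhds.1 hx _ hW
  have hcb' : dist (e c) (e x) < r := hcb
  have hsub := hφ e (IsManifold.chart_mem_maximalAtlas x)
  have hball : Metric.closedBall (e c) (2 * r) ⊆ Metric.closedBall (e x) R :=
    Metric.closedBall_subset_closedBall' (by linarith)
  have hae := hsub.ae_ne_bot (hball.trans hRU) (by rwa [e.left_inv hce])
  refine mem_of_superset hW fun y hy => mem_closure_iff_nhds.2 fun O hO => ?_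
  have hy2 : dist (e y) (e x) < r := hy.2
  have hyb : Metric.ball (e c) (2 * r) ∈ 𝓝 (e y) := by
    refine Metric.isOpen_ball.mem_nhds ?_
    rw [Metric.mem_ball]
    have := dist_triangle_right (e y) (e c) (e x)
    linarith
  obtain ⟨z, hzO, hz⟩ := exists_mem_of_ae_chart (p := fun y => y ∈ U ∧ φ y ≠ ⊥) hy.1 hyb
    (by filter_upwards [hae] with z hz hzb using
      ⟨(hRU (hball (Metric.ball_subset_closedBall hzb))).2, hz hzb⟩) hO
  exact ⟨z, hzO, hz⟩

/-- A subharmonic function `φ ≢ -∞` on a connected open set is finite on a dense subset. -/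
theorem IsSubharmonicOn.subset_closure_ne_bot {φ : M → EReal} {U : Set M} (hφ : IsSubharmonicOn φ U)
    (hU : IsOpen U) (hUc : IsConnected U) (hne : ∃ y ∈ U, φ y ≠ ⊥) :
    U ⊆ closure {y ∈ U | φ y ≠ ⊥} := by
  obtain ⟨y, hyU, hy⟩ := hne
  refine (hUc.isPreconnected.subset_of_closure_inter_subset
    (u := interior (closure {y ∈ U | φ y ≠ ⊥})) isOpen_interior ⟨y, hyU, ?_⟩ ?_).trans
    interior_subset
  · exact mem_interior_iff_mem_nhds.2 (hφ.closure_mem_nhds hU hyU (subset_closure ⟨hyU, hy⟩))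
  · rintro x ⟨hx, hxU⟩
    have hx' : x ∈ closure {y ∈ U | φ y ≠ ⊥} := by
      have := closure_mono interior_subset hx
      rwa [closure_closure] at this
    exact mem_interior_iff_mem_nhds.2 (hφ.closure_mem_nhds hU hxU hx')

/-- Since `φ` may be `⊥` at `x`, the disk is recentred at a point `c` within `a` of `x` where `φ` is
finite: the `8a`-disk around `c` covers the `7a`-disk around `x` and lies in the `9a`-disk. -/
theorem IsSubharmonicOn.ae_chart_ne_bot {φ : M → EReal} {U : Set M} (hφ : IsSubharmonicOn φ U)
    (hU : IsOpen U) (hUc : IsConnected U) (hne : ∃ y ∈ U, φ y ≠ ⊥) {x : M} {a : ℝ} (ha : 0 < a)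
    (hb : Metric.closedBall (chartAt ℂ x x) (9 * a) ⊆
      (chartAt ℂ x).target ∩ (chartAt ℂ x).symm ⁻¹' U) :
    ∀ᵐ z, z ∈ Metric.closedBall (chartAt ℂ x x) (7 * a) → φ ((chartAt ℂ x).symm z) ≠ ⊥ := by
  set e := chartAt ℂ x
  have hxe : x ∈ e.source := mem_chart_source ℂ x
  have hxU : x ∈ U := by
    have := (hb (Metric.mem_closedBall_self (by positivity))).2
    rwa [mem_preimage, e.left_inv hxe] at this
  have hW : e.source ∩ e ⁻¹' Metric.ball (e x) a ∈ 𝓝 x :=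
    inter_mem (e.open_source.mem_nhds hxe)
      ((e.continuousAt hxe).preimage_mem_nhds (Metric.ball_mem_nhds _ ha))
  obtain ⟨c, ⟨hce, hcb⟩, hcU, hcbot⟩ :=
    mem_closure_iff_nhds.1 (hφ.subset_closure_ne_bot hU hUc hne hxU) _ hW
  have hcb' : dist (e c) (e x) < a := hcb
  have hsub := hφ e (IsManifold.chart_mem_maximalAtlas x)
  have hae := hsub.ae_ne_bot (c := e c) (r := 8 * a)
    ((Metric.closedBall_subset_closedBall' (by linarith)).trans hb) (by rwa [e.left_inv hce])
  filter_upwards [hae] with z hz hzb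
  refine hz ?_
  rw [Metric.mem_closedBall] at hzb
  rw [Metric.mem_ball]
  have := dist_triangle_right z (e c) (e x)
  linarith

/-- The complement of a locally polar set is dense. -/
theorem IsLocallyPolar.dense_compl {K : Set M} (hK : IsLocallyPolar K) : Dense Kᶜ := by
  intro x
  by_cases hx : x ∈ K
  · obtain ⟨U, hU, hUc, hxU, φ, hφ, hne, hKU⟩ := hK x hx
    have hxe : x ∈ (chartAt ℂ x).source := mem_chart_source ℂ x
    obtain ⟨r, hr, hrU⟩ := exists_chart_ball hxe (hU.mem_nhds hxU)
    have hae := hφ.ae_chart_ne_bot hU hUc hne (x := x) (a := r / 9) (by positivity)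
      (by rwa [mul_div_cancel₀ _ (by norm_num)])
    refine mem_closure_iff_nhds.2 fun O hO => ?_
    obtain ⟨y, hy, hyb⟩ := exists_mem_of_ae_chart hxe
      (Metric.closedBall_mem_nhds _ (by positivity)) (p := fun y => φ y ≠ ⊥) hae
      (inter_mem hO (hU.mem_nhds hxU))
    exact ⟨y, hy.1, fun hyK => hyb (hKU ⟨hyK, hy.2⟩).2⟩
  · exact subset_closure hx

end RiemannSurface

/-! ### Smooth volume measures -/

section Volume

variable {M : Type*} [TopologicalSpace M] [ChartedSpace ℂ M] [T2Space M]
  [MeasurableSpace M] [BorelSpace M] {μ : Measure M}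

/-- The density has a positive lower bound on the compact set `S`, and its inverse serves as `C`.
This carries `L²` bounds from the surface to the chart. -/
theorem IsSmoothVolume.exists_lintegral_le (hμ : IsSmoothVolume μ) {e : OpenPartialHomeomorph M ℂ}
    (he : e ∈ atlas ℂ M) {S : Set ℂ} (hS : IsCompact S) (hSe : S ⊆ e.target) :
    ∃ C : ℝ≥0∞, C ≠ ⊤ ∧ ∀ g : M → ℝ≥0∞, Measurable g →
      ∫⁻ z in S, g (e.symm z) ≤ C * ∫⁻ x, g x ∂μ := by
  classical
  obtain ⟨ρ, hρ, hρ0, hρμ⟩ := hμ e he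
  obtain ⟨c, hc, hcρ⟩ := hS.exists_forall_le' (hρ.continuousOn.mono hSe) (a := 0)
    fun z hz => hρ0 z (hSe hz)
  refine ⟨(ENNReal.ofReal c)⁻¹, ENNReal.inv_ne_top.2 (ENNReal.ofReal_pos.2 hc).ne',
    fun g hg => ?_⟩
  rcases S.eq_empty_or_nonempty with rfl | ⟨z₀, hz₀⟩
  · simp
  have hSm := hS.isClosed.measurableSet
  -- The chart inverse made globally measurable; only its values on `S` matter.
  set q : ℂ → M := S.piecewise e.symm fun _ => e.symm z₀ with hq
  have hqm : Measurable q :=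
    (e.continuousOn_symm.mono hSe).measurable_piecewise continuousOn_const hSm
  have hqS : ∀ z ∈ S, q z = e.symm z := fun z hz => piecewise_eq_of_mem _ _ _ hz
  have hmap : Measure.map q (volume.restrict S) ≤ (ENNReal.ofReal c)⁻¹ • μ := by
    refine Measure.le_iff.2 fun A hA => ?_
    rw [Measure.map_apply hqm hA, Measure.restrict_apply (hqm hA), Measure.smul_apply, smul_eq_mul]
    have hTm : MeasurableSet (q ⁻¹' A ∩ S) := (hqm hA).inter hSm
    set A' := A ∩ e.symm '' S with hA'
    have hA'm : MeasurableSet A' :=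
      hA.inter (hS.image_of_continuousOn (e.continuousOn_symm.mono hSe)).isClosed.measurableSet
    have hA's : A' ⊆ e.source := by
      rintro _ ⟨_, z, hz, rfl⟩
      exact e.map_target (hSe hz)
    have himg : e '' A' = q ⁻¹' A ∩ S := by
      ext z
      constructor
      · rintro ⟨_, ⟨hx, w, hw, rfl⟩, rfl⟩
        rw [e.right_inv (hSe hw)]
        refine ⟨?_, hw⟩
        rwa [mem_preimage, hqS w hw]
      · rintro ⟨hzA, hz⟩
        rw [mem_preimage, hqS z hz] at hzA
        exact ⟨e.symm z, ⟨hzA, z, hz, rfl⟩, e.right_inv (hSe hz)⟩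
    have h1 : ENNReal.ofReal c * volume (q ⁻¹' A ∩ S) ≤ μ A := by
      refine le_trans ?_ (measure_mono (inter_subset_left : A' ⊆ A))
      rw [hρμ A' hA's hA'm, himg, ← setLIntegral_const]
      exact setLIntegral_mono' hTm fun z hz => ENNReal.ofReal_le_ofReal (hcρ z hz.2)
    rwa [← ENNReal.div_eq_inv_mul, ENNReal.le_div_iff_mul_le
      (Or.inl (ENNReal.ofReal_pos.2 hc).ne') (Or.inl ENNReal.ofReal_ne_top), mul_comm]
  calc ∫⁻ z in S, g (e.symm z) = ∫⁻ z in S, g (q z) :=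
        setLIntegral_congr_fun hSm fun z hz => by rw [hqS z hz]
    _ = ∫⁻ x, g x ∂(Measure.map q (volume.restrict S)) := (lintegral_map hg hqm).symm
    _ ≤ ∫⁻ x, g x ∂((ENNReal.ofReal c)⁻¹ • μ) := lintegral_mono' hmap le_rfl
    _ = _ := by rw [lintegral_smul_measure, smul_eq_mul]

/-- The density is bounded above on small closed chart disks, and finitely many of these cover `M`.
-/
theorem IsSmoothVolume.isFiniteMeasure [CompactSpace M] (hμ : IsSmoothVolume μ) :
    IsFiniteMeasure μ := by
  refine ⟨isCompact_univ.measure_lt_top_of_nhdsWithin fun x _ => ?_⟩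
  rw [nhdsWithin_univ]
  set e := chartAt ℂ x
  have hxe : x ∈ e.source := mem_chart_source ℂ x
  obtain ⟨r, hr, hrt⟩ := exists_chart_ball hxe (univ_mem (f := 𝓝 x))
  have hrt' : Metric.closedBall (e x) r ⊆ e.target := fun z hz => (hrt hz).1
  obtain ⟨ρ, hρ, hρ0, hρμ⟩ := hμ e (chart_mem_atlas ℂ x)
  have hc := isCompact_closedBall (e x) r
  obtain ⟨C, hC⟩ := hc.bddAbove_image (hρ.continuousOn.mono hrt')
  refine ⟨e.symm '' Metric.closedBall (e x) r, ?_, ?_⟩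
  · have hW : e.source ∩ e ⁻¹' Metric.ball (e x) r ∈ 𝓝 x :=
      inter_mem (e.open_source.mem_nhds hxe)
        ((e.continuousAt hxe).preimage_mem_nhds (Metric.ball_mem_nhds _ hr))
    refine mem_of_superset hW fun y hy => ⟨e y, Metric.ball_subset_closedBall hy.2, e.left_inv hy.1⟩
  · rw [hρμ _ (by rintro _ ⟨z, hz, rfl⟩; exact e.map_target (hrt' hz))
      (hc.image_of_continuousOn (e.continuousOn_symm.mono hrt')).isClosed.measurableSet,
      show e '' (e.symm '' Metric.closedBall (e x) r) = Metric.closedBall (e x) r from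
        e.toPartialEquiv.image_symm_image_of_subset_target hrt']
    refine (setLIntegral_mono' (g := fun _ => ENNReal.ofReal C) hc.isClosed.measurableSet
      fun z hz => ENNReal.ofReal_le_ofReal (hC ⟨z, hz, rfl⟩)).trans_lt ?_
    rw [setLIntegral_const]
    exact ENNReal.mul_lt_top ENNReal.ofReal_lt_top hc.measure_lt_top

end Volume

/-! ### Hermitian metrics on compact sets -/

section Metric

variable {M : Type*} [TopologicalSpace M] [ChartedSpace ℂ M]
  {F : Type*} [NormedAddCommGroup F] [NormedSpace ℂ F] [FiniteDimensional ℂ F]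
  {E : M → Type*} [∀ x, AddCommGroup (E x)] [∀ x, Module ℂ (E x)]
  [TopologicalSpace (TotalSpace F E)] [∀ x, TopologicalSpace (E x)]
  [FiberBundle F E] [VectorBundle ℂ F E]

theorem SmoothHermitianMetric.continuousOn_symm (h : SmoothHermitianMetric F E)
    (e : Trivialization F (π F E)) [MemTrivializationAtlas e] :
    ContinuousOn (fun q : M × F => (h.form q.1 (e.symm q.1 q.2) (e.symm q.1 q.2)).re)
      (e.baseSet ×ˢ univ) := by
  let b := Module.finBasis ℂ F
  have hrepr : ∀ i, Continuous fun q : M × F => b.repr q.2 i := fun i =>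
    ((b.coord i).continuous_of_finiteDimensional).comp continuous_snd
  have hcoef : ∀ i j, ContinuousOn
      (fun q : M × F => h.form q.1 (e.symm q.1 (b i)) (e.symm q.1 (b j))) (e.baseSet ×ˢ univ) :=
    fun i j => (h.smooth e (b i) (b j)).continuousOn.comp continuousOn_fst fun q hq => hq.1
  have hsum : ContinuousOn (fun q : M × F => (∑ i, ∑ j, star (b.repr q.2 i) * (b.repr q.2 j *
        h.form q.1 (e.symm q.1 (b i)) (e.symm q.1 (b j)))).re) (e.baseSet ×ˢ univ) := by
    refine Complex.continuous_re.comp_continuousOn ?_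
    refine continuousOn_finsetSum _ fun i _ => continuousOn_finsetSum _ fun j _ => ?_
    exact ((hrepr i).star.continuousOn).mul ((hrepr j).continuousOn.mul (hcoef i j))
  refine hsum.congr fun q hq => ?_
  have hsy : e.symm q.1 q.2 = ∑ i, b.repr q.2 i • e.symm q.1 (b i) := by
    have h1 : ∀ v, e.symm q.1 v = e.symmₗ ℂ q.1 v := fun v => by
      rw [Trivialization.symmₗ_apply _ hq.1]
    simp only [h1]
    conv_lhs => rw [← b.sum_repr q.2]
    rw [map_sum]
    exact Finset.sum_congr rfl fun i _ => map_smul _ _ _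
  simp only
  congr 1
  rw [hsy]
  simp only [map_sum, LinearMap.sum_apply, map_smulₛₗ, LinearMap.smul_apply, smul_eq_mul,
    Finset.mul_sum, RingHom.id_apply]
  rw [Finset.sum_comm]
  refine Finset.sum_congr rfl fun i _ => Finset.sum_congr rfl fun j _ => ?_
  rw [starRingEnd_apply]
  ring

/-- The metric is continuous and positive on the compact product of `N` with the unit sphere of `F`,
hence bounded below there; homogeneity extends the bound to all vectors. -/
theorem SmoothHermitianMetric.exists_norm_sq_le (h : SmoothHermitianMetric F E)
    (e : Trivialization F (π F E)) [MemTrivializationAtlas e] {N : Set M} (hN : IsCompact N)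
    (hNe : N ⊆ e.baseSet) :
    ∃ C : ℝ, ∀ x ∈ N, ∀ v : E x, ‖(e ⟨x, v⟩).2‖ ^ 2 ≤ C * (h.form x v v).re := by
  have : ProperSpace F := FiniteDimensional.proper ℂ F
  have hne : ∀ x ∈ N, ∀ w : F, w ≠ 0 → e.symm x w ≠ 0 := fun x hx w hw h0 => by
    have h1 := e.apply_mk_symm (hNe hx) w
    have h2 := (e.linear ℂ (hNe hx)).map_zero
    rw [h0] at h1
    rw [h1] at h2
    exact hw h2
  obtain ⟨c, hc, hcH⟩ := (hN.prod (isCompact_sphere (0 : F) 1)).exists_forall_le'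
    ((h.continuousOn_symm e).mono (prod_mono hNe (subset_univ _))) (a := 0) fun q hq =>
      h.pos _ _ (hne q.1 hq.1 q.2 (ne_zero_of_mem_unit_sphere ⟨q.2, hq.2⟩))
  refine ⟨c⁻¹, fun x hx v => ?_⟩
  set w := (e ⟨x, v⟩).2 with hw
  have hv : v = e.symm x w := (e.symm_apply_apply_mk (hNe hx) v).symm
  rcases eq_or_ne w 0 with h0 | h0
  · rw [h0, norm_zero, zero_pow two_ne_zero]
    exact mul_nonneg (inv_pos.2 hc).le (h.re_nonneg x v)
  · have hn : 0 < ‖w‖ := norm_pos_iff.2 h0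
    have h1 := hcH (x, (‖w‖⁻¹ : ℂ) • w) ⟨hx, by
      rw [mem_sphere_zero_iff_norm, norm_smul, norm_inv, Complex.norm_real, norm_norm,
        inv_mul_cancel₀ hn.ne']⟩
    have h2 : e.symm x ((‖w‖⁻¹ : ℂ) • w) = (‖w‖⁻¹ : ℂ) • v := by
      rw [← Trivialization.symmₗ_apply (R := ℂ) _ (hNe hx), map_smul,
        Trivialization.symmₗ_apply _ (hNe hx), ← hv]
    simp only [h2] at h1
    have h3 : (h.form x ((‖w‖⁻¹ : ℂ) • v) ((‖w‖⁻¹ : ℂ) • v)).re =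
        (‖w‖ ^ 2)⁻¹ * (h.form x v v).re := by
      rw [← Complex.ofReal_inv]
      simp only [map_smulₛₗ, LinearMap.smul_apply, smul_eq_mul, RingHom.id_apply,
        Complex.conj_ofReal, Complex.re_ofReal_mul]
      field_simp
    rw [h3, ← div_eq_inv_mul, le_div_iff₀ (by positivity)] at h1
    rw [← div_eq_inv_mul, le_div_iff₀ hc, mul_comm]
    exact h1

end Metric

/-! ### Extension of holomorphic sections -/

section Extension

set_option linter.unusedSectionVars false

variable {M : Type*} [TopologicalSpace M] [ChartedSpace ℂ M]
  {F : Type*} [NormedAddCommGroup F] [NormedSpace ℂ F]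
  {E : M → Type*} [∀ x, AddCommGroup (E x)] [∀ x, Module ℂ (E x)]
  [TopologicalSpace (TotalSpace F E)] [∀ x, TopologicalSpace (E x)]
  [FiberBundle F E] [VectorBundle ℂ F E]

/-- The extension by zero of a section over an open set. -/
noncomputable def extendByZero {M : Type*} [TopologicalSpace M] {E : M → Type*}
    [∀ x, AddCommGroup (E x)] {D : Opens M} (s : ∀ x : D, E x) (x : M) : E x :=
  open Classical in if hx : x ∈ D then s ⟨x, hx⟩ else 0

theorem extendByZero_of_mem {M : Type*} [TopologicalSpace M] {E : M → Type*}
    [∀ x, AddCommGroup (E x)] {D : Opens M} (s : ∀ x : D, E x) {x : M} (hx : x ∈ D) :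
    extendByZero s x = s ⟨x, hx⟩ :=
  dif_pos hx

theorem extendByZero_of_notMem {M : Type*} [TopologicalSpace M] {E : M → Type*}
    [∀ x, AddCommGroup (E x)] {D : Opens M} (s : ∀ x : D, E x) {x : M} (hx : x ∉ D) :
    extendByZero s x = 0 :=
  dif_neg hx

theorem IsHolomorphicSection.contMDiffAt_extendByZero {D : Opens M} {s : ∀ x : D, E x}
    (hs : IsHolomorphicSection F s) {x : M} (hx : x ∈ D) :
    ContMDiffAt 𝓘(ℂ, ℂ) (𝓘(ℂ, ℂ).prod 𝓘(ℂ, F)) ω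
      (fun y => TotalSpace.mk' F y (extendByZero s y)) x := by
  refine (contMDiffAt_subtype_iff (U := D) (x := ⟨x, hx⟩)).1 ((hs ⟨x, hx⟩).congr_of_eventuallyEq ?_)
  exact Eventually.of_forall fun y => by simp only [extendByZero_of_mem s y.2]

/-- The square of the pointwise norm of a section, extended by zero. -/
noncomputable def normSqExtend (h : SmoothHermitianMetric F E) {D : Opens M} (s : ∀ x : D, E x)
    (x : M) : ℝ≥0∞ :=
  ENNReal.ofReal (h.form x (extendByZero s x) (extendByZero s x)).re

theorem measurable_normSqExtend [MeasurableSpace M] [BorelSpace M] [FiniteDimensional ℂ F]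
    (h : SmoothHermitianMetric F E) {D : Opens M} {s : ∀ x : D, E x}
    (hs : IsHolomorphicSection F s) : Measurable (normSqExtend h s) := by
  refine measurable_of_restrict_of_restrict_compl D.isOpen.measurableSet ?_ ?_
  · have h1 : (D : Set M).domRestrict (normSqExtend h s) =
        fun x : D => ENNReal.ofReal (h.form x (s x) (s x)).re :=
      funext fun x => by
        rw [Set.domRestrict_apply, normSqExtend, extendByZero_of_mem s x.2]
        rfl
    rw [h1]
    exact (hs.continuous_normSq h).measurable.ennreal_ofReal
  · have h1 : (D : Set M)ᶜ.domRestrict (normSqExtend h s) = fun _ => 0 :=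
      funext fun x => by
        rw [Set.domRestrict_apply, normSqExtend, extendByZero_of_notMem s x.2]
        simp
    rw [h1]
    exact measurable_const

theorem normSqL2_eq [MeasurableSpace M] [BorelSpace M]
    (h : SmoothHermitianMetric F E) (μ : Measure M) {D : Opens M} (s : ∀ x : D, E x) :
    normSqL2 h μ s = ∫⁻ x, normSqExtend h s x ∂μ := by
  have h1 : normSqL2 h μ s = ∫⁻ x : D, normSqExtend h s x ∂(μ.comap (Subtype.val : D → M)) := by
    refine lintegral_congr fun x => ?_
    rw [normSqExtend, extendByZero_of_mem s x.2]
  rw [h1]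
  refine (lintegral_subtype_comap D.isOpen.measurableSet _).trans
    (setLIntegral_eq_of_support_subset ?_)
  intro x hx
  by_contra hxD
  exact hx (by simp [normSqExtend, extendByZero_of_notMem s hxD])

/-- In a trivialization both sections are continuous with values in the Hausdorff space `F`, so
limits along `D` determine the value at `x`. This serves both the gluing and the uniqueness. -/
theorem section_eq_of_eventually_eq_of_dense {σ τ : ∀ x, E x} {D : Set M} (hD : Dense D) {x : M}
    (hσ : ContMDiffAt 𝓘(ℂ, ℂ) (𝓘(ℂ, ℂ).prod 𝓘(ℂ, F)) ω (fun y => TotalSpace.mk' F y (σ y)) x)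
    (hτ : ContMDiffAt 𝓘(ℂ, ℂ) (𝓘(ℂ, ℂ).prod 𝓘(ℂ, F)) ω (fun y => TotalSpace.mk' F y (τ y)) x)
    (h : ∀ᶠ y in 𝓝 x, y ∈ D → σ y = τ y) : σ x = τ x := by
  have : (𝓝[D] x).NeBot := mem_closure_iff_nhdsWithin_neBot.1 (hD x)
  set t := trivializationAt F E x
  have hx : x ∈ t.baseSet := FiberBundle.mem_baseSet_trivializationAt' x
  have h1 := ((contMDiffAt_section x).1 hσ).continuousAt.mono_left (nhdsWithin_le_nhds (s := D))
  have h2 := ((contMDiffAt_section x).1 hτ).continuousAt.mono_left (nhdsWithin_le_nhds (s := D))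
  have h3 : (fun y => (t ⟨y, σ y⟩).2) =ᶠ[𝓝[D] x] fun y => (t ⟨y, τ y⟩).2 := by
    filter_upwards [nhdsWithin_le_nhds h, self_mem_nhdsWithin] with y hy hyD
    rw [hy hyD]
  have h4 : (t ⟨x, σ x⟩).2 = (t ⟨x, τ x⟩).2 := tendsto_nhds_unique (h1.congr' h3) h2
  rw [← t.symm_apply_apply_mk hx (σ x), h4, t.symm_apply_apply_mk hx]

theorem restrict_mem_holomorphicL2 [CompactSpace M] [MeasurableSpace M] [BorelSpace M]
    [FiniteDimensional ℂ F] (h : SmoothHermitianMetric F E) (μ : Measure M) [IsFiniteMeasure μ]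
    (D : Opens M) (S : Cₛ^ω⟮𝓘(ℂ, ℂ); F, E⟯) :
    (fun x : D => S x) ∈ holomorphicL2 h μ D := by
  have hhol : ∀ D : Opens M, IsHolomorphicSection F fun x : D => S x := fun D x =>
    contMDiffAt_subtype_iff.2 (S.contMDiff x)
  refine ⟨hhol D, ?_⟩
  have hc := (hhol ⊤).continuous_normSq h
  have hc' : Continuous fun x : M => (h.form x (S x) (S x)).re :=
    hc.comp (f := fun x : M => (⟨x, trivial⟩ : (⊤ : Opens M)))
      (Continuous.subtype_mk continuous_id _)
  obtain ⟨C, hC⟩ := isCompact_univ.bddAbove_image hc'.continuousOn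
  rw [normSqL2_eq]
  refine (lintegral_mono (g := fun _ => ENNReal.ofReal C) fun x => ?_).trans_lt ?_
  · by_cases hx : x ∈ D
    · rw [normSqExtend, extendByZero_of_mem _ hx]
      exact ENNReal.ofReal_le_ofReal (hC ⟨x, mem_univ _, rfl⟩)
    · simp [normSqExtend, extendByZero_of_notMem _ hx]
  · rw [lintegral_const]
    exact ENNReal.mul_lt_top ENNReal.ofReal_lt_top (measure_lt_top _ _)

variable [IsManifold 𝓘(ℂ, ℂ) ω M] [ContMDiffVectorBundle ω F E 𝓘(ℂ, ℂ)]

theorem exists_extension_near_polar [T2Space M] [MeasurableSpace M] [BorelSpace M]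
    [FiniteDimensional ℂ F] {h : SmoothHermitianMetric F E} {μ : Measure M}
    (hμ : IsSmoothVolume μ) {D : Opens M} (hK : IsLocallyPolar ((D : Set M)ᶜ))
    {s : ∀ x : D, E x} (hs : IsHolomorphicSection F s) (hsL : normSqL2 h μ s < ⊤) {p : M}
    (hp : p ∉ D) :
    ∃ W ∈ 𝓝 p, ∃ σ : ∀ x, E x, (∀ x ∈ W, ContMDiffAt 𝓘(ℂ, ℂ) (𝓘(ℂ, ℂ).prod 𝓘(ℂ, F)) ω
      (fun y => TotalSpace.mk' F y (σ y)) x) ∧ ∀ x ∈ W, x ∈ D → σ x = extendByZero s x := by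
  have : CompleteSpace F := FiniteDimensional.complete ℂ F
  have : ProperSpace F := FiniteDimensional.proper ℂ F
  obtain ⟨U, hU, hUc, hpU, φ, hφ, hne, hKU⟩ := hK p hp
  set e := chartAt ℂ p with he
  have hpe : p ∈ e.source := mem_chart_source ℂ p
  have hem : e ∈ IsManifold.maximalAtlas 𝓘(ℂ, ℂ) ω M := IsManifold.chart_mem_maximalAtlas p
  set t := trivializationAt F E p with ht
  have hpt : p ∈ t.baseSet := FiberBundle.mem_baseSet_trivializationAt' p
  obtain ⟨R, hR, hRV⟩ := exists_chart_ball hpe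
    (inter_mem (hU.mem_nhds hpU) (t.open_baseSet.mem_nhds hpt))
  -- The `9a`-disk leaves room for `ae_chart_ne_bot`, the weight lives on the `7a`-disk, `f` on the
  -- `6a`-disk, and the extension is obtained on the `2a`-disk.
  set a := R / 9 with ha_def
  have ha : 0 < a := by positivity
  have hRa : R = 9 * a := by rw [ha_def]; ring
  set z₀ := e p with hz₀
  have hsubR : ∀ {k : ℝ}, k ≤ 9 → Metric.closedBall z₀ (k * a) ⊆ Metric.closedBall z₀ R :=
    fun hk => Metric.closedBall_subset_closedBall (by rw [hRa]; nlinarith)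
  have htgt : ∀ {z}, z ∈ Metric.closedBall z₀ R → z ∈ e.target := fun hz => (hRV hz).1
  have hUz : ∀ {z}, z ∈ Metric.closedBall z₀ R → e.symm z ∈ U := fun hz => (hRV hz).2.1
  have hbz : ∀ {z}, z ∈ Metric.closedBall z₀ R → e.symm z ∈ t.baseSet := fun hz => (hRV hz).2.2
  have hae := hφ.ae_chart_ne_bot hU hUc hne (x := p) ha
    (by rw [← hRa]; exact fun z hz => ⟨htgt hz, hUz hz⟩)
  set K : Set ℂ := e.symm ⁻¹' (D : Set M)ᶜ with hKdef
  have hDo : IsOpen (e.target ∩ e.symm ⁻¹' (D : Set M)) := e.isOpen_inter_preimage_symm D.isOpen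
  have hKc : IsCompact (K ∩ Metric.closedBall z₀ (6 * a)) := by
    have : K ∩ Metric.closedBall z₀ (6 * a) =
        Metric.closedBall z₀ (6 * a) \ (e.target ∩ e.symm ⁻¹' (D : Set M)) := by
      ext z
      constructor
      · rintro ⟨h1, h2⟩
        exact ⟨h2, fun h3 => h1 h3.2⟩
      · rintro ⟨h1, h2⟩
        exact ⟨fun h3 => h2 ⟨htgt (hsubR (by norm_num) h1), h3⟩, h1⟩
    rw [this]
    exact (isCompact_closedBall _ _).diff hDo
  have hKφ : ∀ z ∈ K ∩ Metric.closedBall z₀ (6 * a), φ (e.symm z) = ⊥ := fun z hz =>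
    (hKU ⟨hz.1, hUz (hsubR (by norm_num) hz.2)⟩).2
  set f₀ : ℂ → F := fun z => (t ⟨e.symm z, extendByZero s (e.symm z)⟩).2 with hf₀
  set O : Set ℂ := Metric.ball z₀ (6 * a) ∩ (e.target ∩ e.symm ⁻¹' (D : Set M)) with hO
  have hOo : IsOpen O := Metric.isOpen_ball.inter hDo
  have hO6 : ∀ {z}, z ∈ O → z ∈ Metric.closedBall z₀ (6 * a) := fun hz =>
    Metric.ball_subset_closedBall hz.1
  have hf₀d : ∀ z ∈ O, DifferentiableAt ℂ f₀ z := by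
    intro z hz
    have h1 := hs.contMDiffAt_extendByZero hz.2.2
    rw [t.contMDiffAt_section_iff (hbz (hsubR (by norm_num) (hO6 hz)))] at h1
    have h2 := contMDiffAt_symm_of_mem_maximalAtlas hem hz.2.1
    have h3 : ContMDiffAt 𝓘(ℂ, ℂ) 𝓘(ℂ, F) ω f₀ z := h1.comp z h2
    exact (contMDiffAt_iff_contDiffAt.1 h3).differentiableAt (by simp)
  set f : ℂ → F := O.indicator f₀ with hf
  have hfO : ∀ z ∈ O, f z = f₀ z := fun z hz => indicator_of_mem hz _
  have hfm : StronglyMeasurable f := by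
    classical
    borelize F
    have hc : ContinuousOn f₀ O := fun z hz => (hf₀d z hz).continuousAt.continuousWithinAt
    have h1 : Measurable (O.piecewise f₀ 0) :=
      hc.measurable_piecewise continuousOn_const hOo.measurableSet
    rw [piecewise_eq_indicator] at h1
    exact h1.stronglyMeasurable
  have hfd : ∀ z ∈ Metric.ball z₀ (6 * a) \ K, DifferentiableAt ℂ f z := by
    intro z hz
    have hzO : z ∈ O := ⟨hz.1, htgt (hsubR (by norm_num) (Metric.ball_subset_closedBall hz.1)),
      not_not.1 hz.2⟩
    refine (hf₀d z hzO).congr_of_eventuallyEq ?_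
    filter_upwards [hOo.mem_nhds hzO] with w hw using hfO w hw
  have hBt : Metric.closedBall z₀ (6 * a) ⊆ e.target := fun z hz => htgt (hsubR (by norm_num) hz)
  have hBc : IsCompact (Metric.closedBall z₀ (6 * a)) := isCompact_closedBall _ _
  obtain ⟨C, hC⟩ := h.exists_norm_sq_le t (N := e.symm '' Metric.closedBall z₀ (6 * a))
    (hBc.image_of_continuousOn (e.continuousOn_symm.mono hBt))
    (by rintro _ ⟨z, hz, rfl⟩; exact hbz (hsubR (by norm_num) hz))
  obtain ⟨C', hC', hint⟩ := hμ.exists_lintegral_le (chart_mem_atlas ℂ p) hBc hBt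
  have hpt : ∀ z, ENNReal.ofReal (‖f z‖ ^ 2) ≤ (Metric.closedBall z₀ (6 * a)).indicator
      (fun z => ENNReal.ofReal (max C 0) * normSqExtend h s (e.symm z)) z := by
    intro z
    by_cases hz : z ∈ O
    · rw [hfO z hz, indicator_of_mem (hO6 hz), normSqExtend,
        ← ENNReal.ofReal_mul (le_max_right _ _)]
      refine ENNReal.ofReal_le_ofReal ((hC _ ⟨z, hO6 hz, rfl⟩ _).trans ?_)
      exact mul_le_mul_of_nonneg_right (le_max_left _ _) (h.re_nonneg _ _)
    · rw [hf, indicator_of_notMem hz, norm_zero, zero_pow two_ne_zero, ENNReal.ofReal_zero]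
      exact zero_le
  have hf2 : Integrable fun z => ‖f z‖ ^ 2 := by
    refine ⟨hfm.norm.pow 2 |>.aestronglyMeasurable, ?_⟩
    rw [hasFiniteIntegral_iff_ofReal (Eventually.of_forall fun z => sq_nonneg _)]
    refine (lintegral_mono hpt).trans_lt ?_
    rw [lintegral_indicator hBc.isClosed.measurableSet, lintegral_const_mul' _ _
      ENNReal.ofReal_ne_top]
    refine ENNReal.mul_lt_top ENNReal.ofReal_lt_top
      ((hint _ (measurable_normSqExtend h hs)).trans_lt ?_)
    rw [← normSqL2_eq]
    exact ENNReal.mul_lt_top hC'.lt_top hsL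
  -- On a set of finite measure `L²` implies `L¹`, here through `‖f‖ ≤ 1 + ‖f‖²`.
  have hf1 : Integrable f := by
    have hb : Integrable ((Metric.closedBall z₀ (6 * a)).indicator fun _ => (1 : ℝ)) :=
      (integrable_indicator_iff hBc.isClosed.measurableSet).2
        (integrableOn_const hBc.measure_lt_top.ne)
    refine (hb.add hf2).mono' hfm.aestronglyMeasurable (Eventually.of_forall fun z => ?_)
    by_cases hz : z ∈ O
    · rw [Pi.add_apply, indicator_of_mem (hO6 hz)]
      nlinarith [sq_nonneg (‖f z‖ - 1)]
    · rw [hf, indicator_of_notMem hz, norm_zero, Pi.add_apply]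
      exact add_nonneg (indicator_nonneg (fun _ _ => zero_le_one) _) (sq_nonneg _)
  obtain ⟨g, hg, hgf⟩ := (hφ e hem).exists_holomorphic_extension ha
    (fun z hz => ⟨htgt (hsubR (by norm_num) hz), hUz (hsubR (by norm_num) hz)⟩) hae hKc hKφ
    hfm hf1 hf2 hfd
  have hW : ∀ {x}, x ∈ e.source ∩ e ⁻¹' Metric.ball z₀ (2 * a) → x ∈ t.baseSet := by
    intro x hx
    have := hbz (hsubR (k := 2) (by norm_num) (Metric.ball_subset_closedBall hx.2))
    rwa [e.left_inv hx.1] at this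
  have hWo : IsOpen (e.source ∩ e ⁻¹' Metric.ball z₀ (2 * a)) :=
    e.isOpen_inter_preimage Metric.isOpen_ball
  refine ⟨e.source ∩ e ⁻¹' Metric.ball z₀ (2 * a), hWo.mem_nhds ⟨hpe, Metric.mem_ball_self
    (by positivity)⟩, fun x => t.symm x (g (e x)), fun x hx => ?_, fun x hx hxD => ?_⟩
  · rw [t.contMDiffAt_section_iff (hW hx)]
    have h1 : ContDiffAt ℂ ω g (e x) :=
      (hg.analyticOnNhd Metric.isOpen_ball (e x) hx.2).contDiffAt
    have h2 : ContMDiffAt 𝓘(ℂ, ℂ) 𝓘(ℂ, F) ω (fun y => g (e y)) x :=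
      h1.contMDiffAt.comp x (contMDiffAt_of_mem_maximalAtlas hem hx.1)
    refine h2.congr_of_eventuallyEq ?_
    filter_upwards [hWo.mem_nhds hx] with y hy
    rw [t.apply_mk_symm (hW hy)]
  · have hxb : e x ∈ Metric.ball z₀ (6 * a) := Metric.ball_subset_ball (by linarith) hx.2
    have hxD' : e.symm (e x) ∈ (D : Set M) := by rwa [e.left_inv hx.1]
    have h1 : g (e x) = f₀ (e x) := by
      rw [hgf ⟨hx.2, fun h => h hxD'⟩]
      exact hfO _ ⟨hxb, e.map_source hx.1, hxD'⟩
    have h2 : f₀ (e x) = (t ⟨x, extendByZero s x⟩).2 := by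
      simp only [hf₀]
      rw [e.left_inv hx.1]
    simp only [h1, h2]
    exact t.symm_apply_apply_mk (hW hx) _

theorem exists_global_extension [T2Space M] [MeasurableSpace M] [BorelSpace M]
    [FiniteDimensional ℂ F] {h : SmoothHermitianMetric F E} {μ : Measure M}
    (hμ : IsSmoothVolume μ) {D : Opens M} (hK : IsLocallyPolar ((D : Set M)ᶜ))
    {s : ∀ x : D, E x} (hs : IsHolomorphicSection F s) (hsL : normSqL2 h μ s < ⊤) :
    ∃ S : Cₛ^ω⟮𝓘(ℂ, ℂ); F, E⟯, ∀ x : D, S x = s x := by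
  have hdense : Dense (D : Set M) := by simpa using hK.dense_compl
  have hloc : ∀ p : M, ∃ W ∈ 𝓝 p, ∃ σ : ∀ x, E x,
      (∀ x ∈ W, ContMDiffAt 𝓘(ℂ, ℂ) (𝓘(ℂ, ℂ).prod 𝓘(ℂ, F)) ω
        (fun y => TotalSpace.mk' F y (σ y)) x) ∧ ∀ x ∈ W, x ∈ D → σ x = extendByZero s x := by
    intro p
    by_cases hp : p ∈ D
    · exact ⟨D, D.isOpen.mem_nhds hp, extendByZero s,
        fun x hx => hs.contMDiffAt_extendByZero hx, fun _ _ _ => rfl⟩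
    · exact exists_extension_near_polar hμ hK hs hsL hp
  choose W hW σ hσ hσs using hloc
  -- The glued section takes at `x` the value of the local extension chosen for `x`. Near `p` it
  -- agrees with the one chosen for `p`, since both extend `s` and `D` is dense; hence it is
  -- holomorphic.
  have heq : ∀ p, ∀ᶠ x in 𝓝 p, σ x x = σ p x := by
    intro p
    filter_upwards [eventually_mem_nhds_iff.2 (hW p)] with x hx
    refine section_eq_of_eventually_eq_of_dense hdense (hσ x x (mem_of_mem_nhds (hW x)))
      (hσ p x (mem_of_mem_nhds hx)) ?_
    filter_upwards [hW x, hx] with y hy hy' hyD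
    rw [hσs x y hy hyD, hσs p y hy' hyD]
  refine ⟨⟨fun x => σ x x, fun p => ?_⟩, fun x => ?_⟩
  · refine (hσ p p (mem_of_mem_nhds (hW p))).congr_of_eventuallyEq ?_
    filter_upwards [heq p] with x hx
    rw [hx]
  · exact (hσs x x (mem_of_mem_nhds (hW x)) x.2).trans (extendByZero_of_mem s x.2)

end Extension

/-! ### The restriction isomorphism -/

theorem mainTheorem2
    {M : Type*} [TopologicalSpace M] [ChartedSpace ℂ M] [IsManifold 𝓘(ℂ, ℂ) ω M]
    [T2Space M] [CompactSpace M] [ConnectedSpace M] [MeasurableSpace M] [BorelSpace M]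
    {F : Type*} [NormedAddCommGroup F] [NormedSpace ℂ F] [FiniteDimensional ℂ F]
    {E : M → Type*} [∀ x, AddCommGroup (E x)] [∀ x, Module ℂ (E x)]
    [TopologicalSpace (TotalSpace F E)] [∀ x, TopologicalSpace (E x)]
    [FiberBundle F E] [VectorBundle ℂ F E] [ContMDiffVectorBundle ω F E 𝓘(ℂ, ℂ)]
    (h : SmoothHermitianMetric F E)
    (μ : Measure M) (hμ : IsSmoothVolume μ)
    (D : Opens M) (hD : IsConnected (D : Set M)) (hK : IsLocallyPolar ((D : Set M)ᶜ)) :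
    ∃ Φ : Cₛ^ω⟮𝓘(ℂ, ℂ); F, E⟯ ≃ₗ[ℂ] holomorphicL2 h μ D,
      ∀ (s : Cₛ^ω⟮𝓘(ℂ, ℂ); F, E⟯) (x : D), (Φ s : ∀ x : D, E x) x = s x := by
  have : IsFiniteMeasure μ := hμ.isFiniteMeasure
  have hdense : Dense (D : Set M) := by simpa using hK.dense_compl
  let R : Cₛ^ω⟮𝓘(ℂ, ℂ); F, E⟯ →ₗ[ℂ] holomorphicL2 h μ D :=
    { toFun := fun S => ⟨fun x : D => S x, restrict_mem_holomorphicL2 h μ D S⟩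
      map_add' := fun S T => rfl
      map_smul' := fun c S => rfl }
  refine ⟨LinearEquiv.ofBijective R ⟨fun S T hST => ?_, fun s => ?_⟩, fun S x => rfl⟩
  · ext x
    refine section_eq_of_eventually_eq_of_dense hdense (S.contMDiff x) (T.contMDiff x)
      (Eventually.of_forall fun y hy => ?_)
    exact congrFun (congrArg Subtype.val hST) ⟨y, hy⟩
  · obtain ⟨S, hS⟩ := exists_global_extension hμ hK s.2.1 s.2.2
    exact ⟨S, Subtype.ext (funext hS)⟩
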